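/- Let $\alpha\in(0,1]$, $\tau>0$, $b_0,c_0,c_1,\delta\in\mathbb R$, and consider the time-fractional delay reaction–diffusion problem $$\frac{\partial^\alpha u}{\partial t^\alpha}=\bigl[D(u)u_x\bigr]_x+R(u,\bar u)\quad (t>0,\ x\in\mathbb R),\qquad u(x,t)=\Phi(x,t)\quad (-\tau\le t\le 0),\tag{crd}$$ where $\bar u=u(x,t-\tau)$, $D(u)=b_0$ and $R(u,\bar u)=c_1u+\delta\bar u+c_0$. Here $\partial^\alpha/\partial t^\alpha$ is the Caputo derivative, $\frac{d^\alpha\varphi}{dt^\alpha}(t)=\frac1{\Gamma(1-\alpha)}\int_0^t\frac{\varphi'(s)}{(t-s)^{\alpha}}\,ds$ for $0<\alpha<1$ ($\varphi$ absolutely continuous on $[0,t]$, with $\varphi'$ its almost everywhere derivative and the integral convergent) and $\varphi'(t)$ for $\alpha=1$. Let $E^{\gamma}_{\alpha,\beta}(z)=\sum_{k\ge0}\frac{(\gamma)_k z^k}{\Gamma(\alpha k+\beta)\,k!}$, with $(\gamma)_k=\Gamma(\gamma+k)/\Gamma(\gamma)$, be the Prabhakar function; let $H(s)=1$ for $s\ge0$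 and $H(s)=0$ for $s<0$, and let $g=1-H$. For $\mu,c\in\mathbb R$ and an absolutely continuous (for instance $C^1$) function $\psi$ on $[-\tau,0]$ let $A[\mu,c,\psi](t)=\psi(t)$ for $-\tau\le t\le0$ and, for $t>0$, $$\begin{aligned}A[\mu,c,\psi](t)={}&\psi(0)\sum_{n=0}^{\lfloor t/\tau\rfloor}\delta^n(t-n\tau)^{\alpha n}E^{n+1}_{\alpha,\alpha n+1}\bigl(\mu(t-n\tau)^\alpha\bigr)\\&+\sum_{n=0}^{\lfloor t/\tau\rfloor}\delta^{n+1}\int_0^t H(r-n\tau)(r-n\tau)^{\alpha n+\alpha-1}E^{n+1}_{\alpha,\alpha n+\alpha}\bigl(\mu(r-n\tau)^\alpha\bigr)\,\psi(t-\tau-r)\,g(t-\tau-r)\,dr\\&+\sum_{n=0}^{\lfloor t/\tau\rfloor}c\,\delta^n(t-n\tau)^{\alpha(n+1)}E^{n+1}_{\alpha,\alpha n+\alpha+1}\bigl(\mu(t-n\tau)^\alpha\bigr),\end{aligned}$$ where an integrand containing the factor $H(r-n\tau)=0$ or $g(t-\tau-r)=0$ is read as $0$. (1) Polynomial solutions.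 The space $\mathrm{Span}\{1,x\}$ is invariant under $\mathcal H[w,\bar w]=[D(w)w_x]_x+R(w,\bar w)=b_0w_{xx}+c_1w+\delta\bar w+c_0$, that is, $\mathcal H[w,\bar w]$ lies in the space whenever $w$ and $\bar w$ do. For all absolutely continuous $\psi,\phi$ on $[-\tau,0]$ the functions $A_1=A[c_1,c_0,\psi]$ and $A_2=A[c_1,0,\phi]$ satisfy, for all $t>0$, $$\frac{d^\alpha A_1}{dt^\alpha}=c_1A_1(t)+\delta A_1(t-\tau)+c_0,\qquad \frac{d^\alpha A_2}{dt^\alpha}=c_1A_2(t)+\delta A_2(t-\tau),$$ with $A_1=\psi$ and $A_2=\phi$ on $[-\tau,0]$, and $$u(x,t)=A_1(t)+A_2(t)\,x\in\mathrm{Span}\{1,x\}$$ solves (crd) with $\Phi(x,t)=\psi(t)+\phi(t)x$. (2) Trigonometric solutions. Let $a_1\ge0$ and $\gamma=c_1-a_1b_0$. The space $\mathrm{Span}\{1,\cos(\sqrt{a_1}x),\sin(\sqrt{a_1}x)\}$ is invariant under $\mathcal H$. For all absolutely continuous $\psi,\phi,\eta$ on $[-\tau,0]$ the functions $A_1=A[c_1,c_0,\psi]$,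 $A_2=A[\gamma,0,\phi]$ and $A_3=A[\gamma,0,\eta]$ satisfy, for all $t>0$, $$\frac{d^\alpha A_1}{dt^\alpha}=c_1A_1(t)+\delta A_1(t-\tau)+c_0,\qquad \frac{d^\alpha A_i}{dt^\alpha}=\gamma A_i(t)+\delta A_i(t-\tau)\quad(i=2,3),$$ with $A_1=\psi$, $A_2=\phi$ and $A_3=\eta$ on $[-\tau,0]$, and $$u(x,t)=A_1(t)+A_2(t)\cos(\sqrt{a_1}x)+A_3(t)\sin(\sqrt{a_1}x)\in\mathrm{Span}\{1,\cos(\sqrt{a_1}x),\sin(\sqrt{a_1}x)\}$$ solves (crd) with $\Phi(x,t)=\psi(t)+\phi(t)\cos(\sqrt{a_1}x)+\eta(t)\sin(\sqrt{a_1}x)$. -/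

import Mathlib

open MeasureTheory

noncomputable section

/-- The Prabhakar (three-parameter Mittag-Leffler) function, for real parameters `α, β, γ > 0`:
`E_{α,β}^γ(z) = ∑ₖ (γ)ₖ zᵏ / (Γ(αk+β) k!)`, with `(γ)ₖ = Γ(γ+k)/Γ(γ)`. -/
def prabhakar (α β γ z : ℝ) : ℝ :=
  ∑' k : ℕ, (Real.Gamma (γ + k) / Real.Gamma γ) * z ^ k /
    (Real.Gamma (α * k + β) * (k.factorial : ℝ))

/-- The Heaviside function: `1` for `t ≥ 0` and `0` for `t < 0`. -/
def heaviside (t : ℝ) : ℝ := if 0 ≤ t then 1 else 0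

/-- The cut-off function: `0` for `t ≥ 0` and `1` for `t < 0`. -/
def cutoff (t : ℝ) : ℝ := if 0 ≤ t then 0 else 1

/-- `φ` has at the time `t > 0` the Caputo derivative `v` of order `α ∈ (0, 1]` (with base
point `0`): for `α = 1` this is the ordinary derivative; for `0 < α < 1`, `φ` is absolutely
continuous on `[0, t]`, the integral below converges, and
`v = 1/Γ(1-α) * ∫₀ᵗ φ'(s) (t-s)^(-α) ds`. -/
def HasCaputoDerivAt (α : ℝ) (φ : ℝ → ℝ) (v t : ℝ) : Prop :=
  (α = 1 ∧ HasDerivAt φ v t) ∨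
  (0 < α ∧ α < 1 ∧ AbsolutelyContinuousOnInterval φ 0 t ∧
    IntervalIntegrable (fun s => deriv φ s / (t - s) ^ α) volume 0 t ∧
    v = 1 / Real.Gamma (1 - α) * ∫ s in (0 : ℝ)..t, deriv φ s / (t - s) ^ α)

/-- The operator `H[w, w̄] = [D(w) w_x]_x + R(w, w̄)` acting on functions of `x`. -/
def rdOperator (D : ℝ → ℝ) (R : ℝ → ℝ → ℝ) (w wbar : ℝ → ℝ) (x : ℝ) : ℝ :=
  deriv (fun y => D (w y) * deriv w y) x + R (w x) (wbar x)

/-- `u = u(x, t)` solves the time-fractional delay reaction-diffusion problem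
`∂^α u/∂t^α = [D(u) u_x]_x + R(u, u(x, t-τ))` for `t > 0`, with `u = Φ` for `t ∈ [-τ, 0]`.
The existence of all the derivatives involved is part of the definition. -/
def IsDelayRDSolution (α τ : ℝ) (D : ℝ → ℝ) (R : ℝ → ℝ → ℝ) (Φ u : ℝ → ℝ → ℝ) : Prop :=
  (∀ x : ℝ, ∀ t ∈ Set.Icc (-τ) 0, u x t = Φ x t) ∧
  (∀ t : ℝ, 0 < t → Differentiable ℝ (fun x => u x t) ∧
    Differentiable ℝ (fun x => D (u x t) * deriv (fun y => u y t) x)) ∧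
  (∀ x t : ℝ, 0 < t → HasCaputoDerivAt α (u x)
    (rdOperator D R (fun y => u y t) (fun y => u y (t - τ)) x) t)

/-- `A` solves the scalar fractional delay equation
`d^α A/dt^α = μ A(t) + δ A(t-τ) + c` for `t > 0`, with `A = ψ` on `[-τ, 0]`. -/
def IsDelayODESolution (α τ μ δ c : ℝ) (ψ A : ℝ → ℝ) : Prop :=
  (∀ t ∈ Set.Icc (-τ) 0, A t = ψ t) ∧
  ∀ t : ℝ, 0 < t → HasCaputoDerivAt α A (μ * A t + δ * A (t - τ) + c) t

/-- The explicit coefficient: it equals `ψ(t)` for `t ≤ 0`, and for `t > 0` it is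
`ψ(0) ∑ₙ δⁿ (t-nτ)^{αn} E^{n+1}_{α,αn+1}(μ(t-nτ)^α)`
`+ ∑ₙ δⁿ⁺¹ ∫₀ᵗ H(r-nτ) (r-nτ)^{αn+α-1} E^{n+1}_{α,αn+α}(μ(r-nτ)^α) ψ(t-τ-r) g(t-τ-r) dr`
`+ ∑ₙ c δⁿ (t-nτ)^{α(n+1)} E^{n+1}_{α,αn+α+1}(μ(t-nτ)^α)`,
each sum over `0 ≤ n ≤ ⌊t/τ⌋`, with `H` the Heaviside function and `g` the cut-off.
For `c = 0` the last sum disappears. -/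
def delayCoeff (α τ μ δ c : ℝ) (ψ : ℝ → ℝ) (t : ℝ) : ℝ :=
  if t ≤ 0 then ψ t else
    ψ 0 * (∑ n ∈ Finset.range (⌊t / τ⌋₊ + 1),
      δ ^ n * (t - n * τ) ^ (α * n) *
        prabhakar α (α * n + 1) (n + 1) (μ * (t - n * τ) ^ α))
    + (∑ n ∈ Finset.range (⌊t / τ⌋₊ + 1),
      δ ^ (n + 1) * ∫ r in (0 : ℝ)..t,
        heaviside (r - n * τ) * (r - n * τ) ^ (α * n + α - 1) *
          prabhakar α (α * n + α) (n + 1) (μ * (r - n * τ) ^ α) *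
            ψ (t - τ - r) * cutoff (t - τ - r))
    + ∑ n ∈ Finset.range (⌊t / τ⌋₊ + 1),
      c * δ ^ n * (t - n * τ) ^ (α * (n + 1)) *
        prabhakar α (α * n + α + 1) (n + 1) (μ * (t - n * τ) ^ α)

/-- `Span{1, x}`. -/
def linearSpace : Submodule ℝ (ℝ → ℝ) :=
  Submodule.span ℝ {fun _ => 1, fun x => x}

/-- `Span{1, cos(√a x), sin(√a x)}`. -/
def trigSpace (a : ℝ) : Submodule ℝ (ℝ → ℝ) :=
  Submodule.span ℝ {fun _ => 1, fun x => Real.cos (√a * x), fun x => Real.sin (√a * x)}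

end

/-! Convolution with `powKernel a` is fractional integration of order a, and `hasConv_powKernel`
(the Beta integral) makes these kernels a semigroup. The Prabhakar kernels `mlKernel` and their
delayed sums K_β = `delayKernel … β` are series in them, so convolution with `powKernel a` takes K_β
to K_{a+β}. Pascal's rule for the coefficients gives `delayKernel_one`: for t > 0, K_1(t) = 1 + μ
K_{α+1}(t) + δ K_{α+1}(t-τ), the integrated delay equation with zero history.

Let h' be the derivative of the history, moved to (0, τ]. Integration by parts turns the explicit
formula for A into ψ(0) + ∫₀ᵗ p, where p = (μψ(0) + δψ(-τ) + c) K_α + δ K_α * h'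
(`delayCoeff_eq_add_integral`). For α < 1 the Caputo derivative of A is `powKernel (1 - α)`
convolved with p, which replaces K_α by K_1; inserting `delayKernel_one` recovers μA(t) + δA(t-τ) +
c (`delayKernel_one_conv`). For α = 1 the same identity shows that p is continuous, and the
fundamental theorem of calculus applies.

The PDE then separates: 1, x, cos and sin are eigenfunctions of the second derivative, and the
Caputo derivative is linear at fixed x. -/

/-! ### Riemann–Liouville kernels and their semigroup law -/

/-- The kernel `t ↦ t ^ (β - 1) / Γ(β)` of the Riemann–Liouville integral of order `β`,
extended by `0` to `t ≤ 0`. -/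
noncomputable def powKernel (β t : ℝ) : ℝ :=
  if 0 < t then t ^ (β - 1) / Real.Gamma β else 0

/-- The pointwise convolution of `f` and `h` converges absolutely everywhere and equals `k`. -/
def HasConv (f h k : ℝ → ℝ) : Prop :=
  ∀ u, Integrable (fun s => f (u - s) * h s) ∧ ∫ s, f (u - s) * h s = k u

theorem powKernel_of_nonpos (β : ℝ) {t : ℝ} (ht : t ≤ 0) : powKernel β t = 0 :=
  if_neg ht.not_gt

theorem powKernel_of_pos (β : ℝ) {t : ℝ} (ht : 0 < t) :
    powKernel β t = t ^ (β - 1) / Real.Gamma β := if_pos ht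

theorem powKernel_one_of_pos {t : ℝ} (ht : 0 < t) : powKernel 1 t = 1 := by
  simp [powKernel_of_pos 1 ht]

theorem powKernel_nonneg {β : ℝ} (hβ : 0 < β) (t : ℝ) : 0 ≤ powKernel β t := by
  unfold powKernel
  split_ifs with h
  · exact div_nonneg (Real.rpow_nonneg h.le _) (Real.Gamma_pos_of_pos hβ).le
  · exact le_rfl

theorem powKernel_mono {β : ℝ} (hβ : 1 ≤ β) : Monotone (powKernel β) := by
  intro s t hst
  rcases le_or_gt s 0 with hs | hs
  · rw [powKernel_of_nonpos β hs]
    exact powKernel_nonneg (by linarith) t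
  · rw [powKernel_of_pos β hs, powKernel_of_pos β (hs.trans_le hst)]
    have := Real.Gamma_pos_of_pos (show 0 < β by linarith)
    gcongr

theorem measurable_powKernel (β : ℝ) : Measurable (powKernel β) := by
  unfold powKernel
  exact Measurable.ite measurableSet_Ioi (by fun_prop) measurable_const

theorem integral_rpow_mul_sub_rpow {a b u : ℝ} (ha : 0 < a) (hb : 0 < b) (hu : 0 < u) :
    ∫ s in (0 : ℝ)..u, (u - s) ^ (a - 1) * s ^ (b - 1) =
      u ^ (a + b - 1) * (Real.Gamma a * Real.Gamma b / Real.Gamma (a + b)) := by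
  have h := Complex.betaIntegral_scaled (b : ℂ) (a : ℂ) hu
  have h1 : ∫ s in (0 : ℝ)..u, (s : ℂ) ^ ((b : ℂ) - 1) * ((u : ℂ) - s) ^ ((a : ℂ) - 1) =
      ((∫ s in (0 : ℝ)..u, (u - s) ^ (a - 1) * s ^ (b - 1) : ℝ) : ℂ) := by
    rw [← intervalIntegral.integral_ofReal]
    refine intervalIntegral.integral_congr fun s hs => ?_
    rw [Set.uIcc_of_le hu.le] at hs
    simp only [Complex.ofReal_mul]
    rw [Complex.ofReal_cpow (by linarith [hs.2]), Complex.ofReal_cpow hs.1]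
    push_cast
    ring
  rw [h1, Complex.betaIntegral_eq_Gamma_mul_div _ _ (by simpa) (by simpa), ← Complex.ofReal_add,
    Complex.Gamma_ofReal, Complex.Gamma_ofReal, Complex.Gamma_ofReal] at h
  have h2 : ((u : ℂ) ^ (((b + a : ℝ) : ℂ) - 1)) = ((u ^ (b + a - 1) : ℝ) : ℂ) := by
    rw [Complex.ofReal_cpow hu.le]
    push_cast
    ring_nf
  rw [h2] at h
  have h3 : (∫ s in (0 : ℝ)..u, (u - s) ^ (a - 1) * s ^ (b - 1)) =
      u ^ (b + a - 1) * (Real.Gamma b * Real.Gamma a / Real.Gamma (b + a)) := by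
    exact_mod_cast h
  rw [h3, add_comm b a, mul_comm (Real.Gamma b)]

theorem hasConv_powKernel {a b : ℝ} (ha : 0 < a) (hb : 0 < b) :
    HasConv (powKernel a) (powKernel b) (powKernel (a + b)) := by
  intro u
  have hGa := Real.Gamma_pos_of_pos ha
  have hGb := Real.Gamma_pos_of_pos hb
  have hGab := Real.Gamma_pos_of_pos (add_pos ha hb)
  rcases le_or_gt u 0 with hu | hu
  · have h0 : (fun s => powKernel a (u - s) * powKernel b s) = fun _ => 0 := by
      funext s
      rcases le_or_gt s 0 with hs | hs
      · rw [powKernel_of_nonpos b hs, mul_zero]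
      · rw [powKernel_of_nonpos a (by linarith), zero_mul]
    rw [h0, powKernel_of_nonpos _ hu]
    simp
  · have h0 : (fun s => powKernel a (u - s) * powKernel b s) =
        (Set.Ioo 0 u).indicator fun s =>
          (u - s) ^ (a - 1) * s ^ (b - 1) / (Real.Gamma a * Real.Gamma b) := by
      funext s
      by_cases hs : s ∈ Set.Ioo 0 u
      · rw [Set.indicator_of_mem hs, powKernel_of_pos _ hs.1,
          powKernel_of_pos _ (sub_pos.2 hs.2)]
        field_simp
      · rw [Set.indicator_of_notMem hs]
        rcases le_or_gt s 0 with hs0 | hs0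
        · rw [powKernel_of_nonpos b hs0, mul_zero]
        · rw [powKernel_of_nonpos a, zero_mul]
          by_contra hlt
          exact hs ⟨hs0, by linarith⟩
    have h1 : ∫ s, powKernel a (u - s) * powKernel b s = powKernel (a + b) u := by
      rw [h0, integral_indicator measurableSet_Ioo, ← integral_Ioc_eq_integral_Ioo,
        ← intervalIntegral.integral_of_le hu.le, intervalIntegral.integral_div,
        integral_rpow_mul_sub_rpow ha hb hu, powKernel_of_pos _ hu]
      field_simp
    refine ⟨?_, h1⟩
    -- A non-integrable function has integral 0 by convention, but the value just computed is
    -- positive.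
    by_contra hni
    rw [integral_undef hni, powKernel_of_pos _ hu] at h1
    exact (div_pos (Real.rpow_pos_of_pos hu _) hGab).ne h1

/-! ### Calculus of convolution identities -/

namespace HasConv

variable {f h k h₁ k₁ : ℝ → ℝ}

theorem comm (H : HasConv f h k) : HasConv h f k := by
  intro u
  obtain ⟨h1, h2⟩ := H u
  have e : (fun s => h (u - s) * f s) = fun s => f (u - (u - s)) * h (u - s) := by
    funext s
    rw [sub_sub_cancel, mul_comm]
  rw [e]
  exact ⟨h1.comp_sub_left u, by
    rw [← h2]
    exact integral_sub_left_eq_self (fun s => f (u - s) * h s) volume u⟩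

theorem add (H : HasConv f h k) (H₁ : HasConv f h₁ k₁) :
    HasConv f (fun t => h t + h₁ t) (fun t => k t + k₁ t) := by
  intro u
  simp only [mul_add]
  exact ⟨(H u).1.add (H₁ u).1, by rw [integral_add (H u).1 (H₁ u).1, (H u).2, (H₁ u).2]⟩

theorem const_mul (H : HasConv f h k) (c : ℝ) :
    HasConv f (fun t => c * h t) (fun t => c * k t) := by
  intro u
  simp only [mul_left_comm _ c]
  exact ⟨(H u).1.const_mul c, by rw [integral_const_mul, (H u).2]⟩

theorem sum {ι : Type*} (s : Finset ι) {h k : ι → ℝ → ℝ} (H : ∀ i ∈ s, HasConv f (h i) (k i)) :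
    HasConv f (fun t => ∑ i ∈ s, h i t) (fun t => ∑ i ∈ s, k i t) := by
  intro u
  simp only [Finset.mul_sum]
  refine ⟨integrable_finsetSum _ fun i hi => (H i hi u).1, ?_⟩
  rw [integral_finsetSum _ fun i hi => (H i hi u).1]
  exact Finset.sum_congr rfl fun i hi => (H i hi u).2

theorem shift (H : HasConv f h k) (c : ℝ) :
    HasConv f (fun t => h (t - c)) (fun t => k (t - c)) := by
  intro u
  obtain ⟨h1, h2⟩ := H (u - c)
  have e : (fun s => f (u - s) * h (s - c)) = fun s => f (u - c - (s - c)) * h (s - c) := by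
    funext s
    ring_nf
  rw [e]
  exact ⟨h1.comp_sub_right c, by
    refine Eq.trans ?_ h2
    exact integral_sub_right_eq_self (fun s => f (u - c - s) * h s) c⟩

/-- Since `f` and every `h i` are nonnegative, the L¹ norm of the i-th integrand is exactly `|c i| *
k i u`, so `hc` is the absolute convergence that permits exchanging sum and integral. -/
theorem tsum {h k : ℕ → ℝ → ℝ} (H : ∀ i, HasConv f (h i) (k i)) (hf : ∀ t, 0 ≤ f t)
    (hh : ∀ i t, 0 ≤ h i t) (c : ℕ → ℝ)
    (hs : ∀ t, Summable fun i => c i * h i t) (hc : ∀ u, Summable fun i => |c i| * k i u) :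
    HasConv f (fun t => ∑' i, c i * h i t) (fun t => ∑' i, c i * k i t) := by
  intro u
  have hi : ∀ i, Integrable fun s => f (u - s) * (c i * h i s) := fun i => ((H i).const_mul (c i) u).1
  have hn : ∀ i, ∫ s, ‖f (u - s) * (c i * h i s)‖ = |c i| * k i u := by
    intro i
    refine Eq.trans ?_ ((H i).const_mul |c i| u).2
    refine integral_congr_ae (Filter.Eventually.of_forall fun s => ?_)
    simp [abs_of_nonneg (hf _), abs_of_nonneg (hh i s)]
  have hsn : Summable fun i => ∫ s, ‖f (u - s) * (c i * h i s)‖ := by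
    simpa only [hn] using hc u
  simp only [← tsum_mul_left]
  constructor
  · refine ⟨aestronglyMeasurable_of_tendsto_ae Filter.atTop
      (f := fun n s => ∑ i ∈ Finset.range n, f (u - s) * (c i * h i s))
      (fun n => (integrable_finsetSum _ fun i _ => hi i).1)
      (Filter.Eventually.of_forall fun s => ((hs s).mul_left _).hasSum.tendsto_sum_nat), ?_⟩
    refine lt_of_le_of_lt (lintegral_mono fun s => enorm_tsum_le_tsum_enorm) ?_
    rw [lintegral_tsum fun i => (hi i).1.enorm]
    have e : ∀ i, ∫⁻ s, ‖f (u - s) * (c i * h i s)‖ₑ =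
        ENNReal.ofReal (∫ s, ‖f (u - s) * (c i * h i s)‖) := fun i =>
      (ofReal_integral_norm_eq_lintegral_enorm (hi i)).symm
    simp only [e]
    rw [← ENNReal.ofReal_tsum_of_nonneg (fun i => integral_nonneg fun s => norm_nonneg _) hsn]
    exact ENNReal.ofReal_lt_top
  · rw [← integral_tsum_of_summable_integral_norm hi hsn]
    exact tsum_congr fun i => ((H i).const_mul (c i) u).2

end HasConv

/-! ### Growth of Γ and convergence of the kernel series -/

/-- Keep only the part of the Gamma integral over (M, ∞), where the power is at least M^(x-1). As M
is free, Γ beats every geometric growth without Stirling's formula. -/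
theorem Real.rpow_mul_exp_neg_le_Gamma {M x : ℝ} (hM : 0 < M) (hx : 1 ≤ x) :
    M ^ (x - 1) * Real.exp (-M) ≤ Real.Gamma x := by
  have hint := Real.GammaIntegral_convergent (show 0 < x by linarith)
  rw [Real.Gamma_eq_integral (by linarith)]
  calc M ^ (x - 1) * Real.exp (-M) = ∫ s in Set.Ioi M, Real.exp (-s) * M ^ (x - 1) := by
        rw [integral_mul_const, integral_exp_neg_Ioi, mul_comm]
    _ ≤ ∫ s in Set.Ioi M, Real.exp (-s) * s ^ (x - 1) := by
        refine setIntegral_mono_on ((integrableOn_exp_neg_Ioi M).mul_const _)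
          (hint.mono_set (Set.Ioi_subset_Ioi hM.le)) measurableSet_Ioi fun s hs => ?_
        have hs' : M < s := hs
        gcongr
    _ ≤ ∫ s in Set.Ioi 0, Real.exp (-s) * s ^ (x - 1) := by
        refine setIntegral_mono_set hint ?_ (Set.Ioi_subset_Ioi hM.le).eventuallyLE
        filter_upwards [ae_restrict_mem measurableSet_Ioi] with s hs
        have hs' : (0 : ℝ) < s := hs
        positivity

theorem summable_choose_mul_powKernel {α : ℝ} (hα : 0 < α) (μ : ℝ) (n : ℕ) (β t : ℝ) :
    Summable fun k : ℕ => ((n + k).choose n : ℝ) * μ ^ k * powKernel (α * k + β) t := by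
  rcases le_or_gt t 0 with ht | ht
  · simp [powKernel_of_nonpos _ ht, summable_zero]
  have hlim : Filter.Tendsto (fun M : ℝ => M ^ α) Filter.atTop Filter.atTop :=
    tendsto_rpow_atTop hα
  -- The binomial coefficient costs a factor 2^k, so a ratio of at most 1/4 from the remaining
  -- factors leaves a geometric series of ratio 1/2.
  obtain ⟨M, hM1, hM0⟩ := ((hlim.eventually_ge_atTop (4 * (|μ| * t ^ α))).and
    (Filter.eventually_gt_atTop 0)).exists
  have hMα : 0 < M ^ α := Real.rpow_pos_of_pos hM0 _
  set C : ℝ := 2 ^ n * (t ^ (β - 1) * (Real.exp M * M ^ (1 - β)))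
  refine Summable.of_norm_bounded_eventually_nat (g := fun k : ℕ => C * (1 / 2 : ℝ) ^ k)
    (summable_geometric_two.mul_left C) ?_
  have hev : ∀ᶠ k : ℕ in Filter.atTop, 1 ≤ α * k + β := by
    have : Filter.Tendsto (fun k : ℕ => α * (k : ℝ) + β) Filter.atTop Filter.atTop :=
      Filter.tendsto_atTop_add_const_right _ _
        (tendsto_natCast_atTop_atTop.const_mul_atTop hα)
    exact this.eventually_ge_atTop 1
  filter_upwards [hev] with k hk
  have hG := Real.rpow_mul_exp_neg_le_Gamma hM0 hk
  have hGp : 0 < Real.Gamma (α * k + β) := Real.Gamma_pos_of_pos (by linarith)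
  have hch : ((n + k).choose n : ℝ) ≤ 2 ^ n * 2 ^ k := by
    rw [← pow_add]
    exact_mod_cast Nat.choose_le_two_pow (n + k) n
  have e1 : t ^ (α * k + β - 1) = (t ^ α) ^ k * t ^ (β - 1) := by
    rw [← Real.rpow_natCast (t ^ α), ← Real.rpow_mul ht.le, ← Real.rpow_add ht]
    ring_nf
  have e2 : M ^ (α * k + β - 1) = (M ^ α) ^ k * M ^ (β - 1) := by
    rw [← Real.rpow_natCast (M ^ α), ← Real.rpow_mul hM0.le, ← Real.rpow_add hM0]
    ring_nf
  have hinv : (Real.Gamma (α * k + β))⁻¹ ≤ ((M ^ α) ^ k)⁻¹ * (Real.exp M * M ^ (1 - β)) := by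
    refine (inv_anti₀ (by positivity) hG).trans (le_of_eq ?_)
    rw [e2, mul_inv, mul_inv, Real.exp_neg, inv_inv, ← Real.rpow_neg hM0.le, neg_sub]
    ring
  have hratio : |μ| * t ^ α * (M ^ α)⁻¹ ≤ 1 / 4 := by
    rw [mul_inv_le_iff₀ hMα]
    linarith
  have htα : 0 < t ^ α := Real.rpow_pos_of_pos ht _
  rw [powKernel_of_pos _ ht, Real.norm_eq_abs, abs_mul, abs_mul, abs_pow, Nat.abs_cast,
    abs_of_nonneg (by positivity : 0 ≤ t ^ (α * k + β - 1) / Real.Gamma (α * k + β)), e1,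
    div_eq_mul_inv]
  calc ((n + k).choose n : ℝ) * |μ| ^ k *
        ((t ^ α) ^ k * t ^ (β - 1) * (Real.Gamma (α * k + β))⁻¹)
      ≤ (2 ^ n * 2 ^ k) * |μ| ^ k * ((t ^ α) ^ k * t ^ (β - 1) *
        (((M ^ α) ^ k)⁻¹ * (Real.exp M * M ^ (1 - β)))) := by gcongr
    _ = C * (2 * (|μ| * t ^ α * (M ^ α)⁻¹)) ^ k := by
        simp only [C, mul_pow, inv_pow]
        ring
    _ ≤ C * (1 / 2) ^ k := by
        have : 0 ≤ C := by positivity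
        gcongr
        linarith

/-! ### Prabhakar kernels -/

/-- The kernel `t ↦ t ^ (β - 1) E_{α,β}^{n+1}(μ t ^ α)`, extended by `0` to `t ≤ 0`. -/
noncomputable def mlKernel (α μ : ℝ) (n : ℕ) (β t : ℝ) : ℝ :=
  ∑' k : ℕ, ((n + k).choose n : ℝ) * μ ^ k * powKernel (α * k + β) t

theorem mlKernel_of_nonpos (α μ : ℝ) (n : ℕ) (β : ℝ) {t : ℝ} (ht : t ≤ 0) :
    mlKernel α μ n β t = 0 := by
  simp [mlKernel, powKernel_of_nonpos _ ht]

/-- The Pochhammer quotient (n+1)_k / k! is the binomial coefficient C(n+k, n). -/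
theorem mlKernel_of_pos (α μ : ℝ) (n : ℕ) (β : ℝ) {t : ℝ} (ht : 0 < t) :
    mlKernel α μ n β t = t ^ (β - 1) * prabhakar α β (n + 1) (μ * t ^ α) := by
  rw [mlKernel, prabhakar, ← tsum_mul_left]
  refine tsum_congr fun k => ?_
  have h1 : Real.Gamma ((n : ℝ) + 1 + k) = ((n + k).factorial : ℝ) := by
    rw [← Real.Gamma_nat_eq_factorial]
    push_cast
    ring_nf
  have h2 : ((n + k).factorial : ℝ) = (n + k).choose n * n.factorial * k.factorial := by
    have := Nat.choose_mul_factorial_mul_factorial (Nat.le_add_right n k)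
    rw [Nat.add_sub_cancel_left] at this
    exact_mod_cast this.symm
  have e1 : t ^ (α * k + β - 1) = (t ^ α) ^ k * t ^ (β - 1) := by
    rw [← Real.rpow_natCast (t ^ α), ← Real.rpow_mul ht.le, ← Real.rpow_add ht]
    ring_nf
  have hn : (n.factorial : ℝ) ≠ 0 := by positivity
  have hk : (k.factorial : ℝ) ≠ 0 := by positivity
  have h3 : ((n + k).choose n : ℝ) = ((n + k).factorial : ℝ) / n.factorial / k.factorial := by
    rw [h2]
    field_simp
  rw [powKernel_of_pos _ ht, h1, Real.Gamma_nat_eq_factorial, e1, mul_pow, h3]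
  simp only [div_eq_mul_inv, mul_inv]
  ring

theorem measurable_mlKernel {α : ℝ} (hα : 0 < α) (μ : ℝ) (n : ℕ) (β : ℝ) :
    Measurable (mlKernel α μ n β) := by
  refine measurable_of_tendsto_metrizable (f := fun N t => ∑ k ∈ Finset.range N,
    ((n + k).choose n : ℝ) * μ ^ k * powKernel (α * k + β) t) (fun N => ?_) ?_
  · exact Finset.measurable_fun_sum _ fun k _ => (measurable_powKernel _).const_mul _
  · rw [tendsto_pi_nhds]
    exact fun t => (summable_choose_mul_powKernel hα μ n β t).hasSum.tendsto_sum_nat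

theorem hasConv_powKernel_mlKernel {α : ℝ} (hα : 0 < α) (μ : ℝ) (n : ℕ) {a β : ℝ} (ha : 0 < a)
    (hβ : 0 < β) :
    HasConv (powKernel a) (mlKernel α μ n β) (mlKernel α μ n (a + β)) := by
  have hpos : ∀ k : ℕ, 0 < α * k + β := fun k => by positivity
  have H : ∀ k : ℕ, HasConv (powKernel a) (powKernel (α * k + β))
      (powKernel (α * k + (a + β))) := fun k => by
    have := hasConv_powKernel ha (hpos k)
    rwa [show a + (α * k + β) = α * k + (a + β) by ring] at this
  refine HasConv.tsum H (powKernel_nonneg ha) (fun k => powKernel_nonneg (hpos k)) _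
    (summable_choose_mul_powKernel hα μ n β) fun u => ?_
  simpa only [abs_mul, abs_pow, Nat.abs_cast] using
    summable_choose_mul_powKernel hα |μ| n (a + β) u

theorem mlKernel_mono {α μ : ℝ} (hα : 0 < α) (hμ : 0 ≤ μ) (n : ℕ) {β : ℝ} (hβ : 1 ≤ β) :
    Monotone (mlKernel α μ n β) := fun s t hst =>
  (summable_choose_mul_powKernel hα μ n β s).tsum_le_tsum
    (fun k => mul_le_mul_of_nonneg_left
      (powKernel_mono (hβ.trans (le_add_of_nonneg_left (by positivity))) hst) (by positivity))
    (summable_choose_mul_powKernel hα μ n β t)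

/-- Together with `mlKernel_mono` this provides a monotone majorant when β ≥ 1, the source of all
later domination bounds. -/
theorem abs_mlKernel_le {α : ℝ} (hα : 0 < α) (μ : ℝ) (n : ℕ) {β : ℝ} (hβ : 0 < β) (t : ℝ) :
    |mlKernel α μ n β t| ≤ mlKernel α |μ| n β t := by
  have e : ∀ k : ℕ, ‖((n + k).choose n : ℝ) * μ ^ k * powKernel (α * k + β) t‖ =
      ((n + k).choose n : ℝ) * |μ| ^ k * powKernel (α * k + β) t := fun k => by
    rw [Real.norm_eq_abs, abs_mul, abs_mul, abs_pow, Nat.abs_cast,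
      abs_of_nonneg (powKernel_nonneg (by positivity) t)]
  have hs := summable_choose_mul_powKernel hα |μ| n β t
  simp only [← e] at hs
  refine (norm_tsum_le_tsum_norm hs).trans (le_of_eq ?_)
  simp only [e, mlKernel]

theorem mlKernel_zero {α : ℝ} (hα : 0 < α) (μ β t : ℝ) :
    mlKernel α μ 0 β t = powKernel β t + μ * mlKernel α μ 0 (β + α) t := by
  have hs := summable_choose_mul_powKernel hα μ 0 β t
  rw [mlKernel, hs.tsum_eq_zero_add, mlKernel, ← tsum_mul_left]
  congr 1
  · simp
  · refine tsum_congr fun k => ?_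
    rw [show α * ((k + 1 : ℕ) : ℝ) + β = α * k + (β + α) by push_cast; ring]
    simp only [Nat.choose_zero_right]
    ring

/-- Pascal's rule, term by term after splitting off k = 0, where both coefficients are 1. In
generating functions: (1 - z)^(-n-2) = (1 - z)^(-n-1) + z (1 - z)^(-n-2). -/
theorem mlKernel_succ {α : ℝ} (hα : 0 < α) (μ : ℝ) (n : ℕ) (β t : ℝ) :
    mlKernel α μ (n + 1) β t =
      mlKernel α μ n β t + μ * mlKernel α μ (n + 1) (β + α) t := by
  have hs := summable_choose_mul_powKernel hα μ n β t
  have hs1 := summable_choose_mul_powKernel hα μ (n + 1) β t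
  have hs2 := (summable_choose_mul_powKernel hα μ (n + 1) (β + α) t).mul_left μ
  have e : ∀ k : ℕ, ((n + 1 + (k + 1)).choose (n + 1) : ℝ) * μ ^ (k + 1) *
      powKernel (α * (k + 1 : ℕ) + β) t =
      ((n + (k + 1)).choose n : ℝ) * μ ^ (k + 1) * powKernel (α * (k + 1 : ℕ) + β) t +
      μ * (((n + 1 + k).choose (n + 1) : ℝ) * μ ^ k * powKernel (α * k + (β + α)) t) := by
    intro k
    rw [show α * ((k + 1 : ℕ) : ℝ) + β = α * k + (β + α) by push_cast; ring,
      show n + 1 + (k + 1) = (n + (k + 1)) + 1 by ring, Nat.choose_succ_succ,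
      show n + 1 + k = n + (k + 1) by ring]
    push_cast
    ring
  rw [mlKernel, hs1.tsum_eq_zero_add, mlKernel, hs.tsum_eq_zero_add, mlKernel, ← tsum_mul_left]
  simp only [e]
  rw [((summable_nat_add_iff 1).2 hs).tsum_add hs2]
  simp
  ring

/-! ### Delay kernels and the integrated delay equation -/

/-- The fundamental kernels of the delay equation, truncated to `N` delays: with `N` large,
`β = 1` gives the solution of the homogeneous equation that starts at `1` with zero history. -/
noncomputable def delayKernel (α τ μ δ : ℝ) (N : ℕ) (β t : ℝ) : ℝ :=
  ∑ n ∈ Finset.range N, δ ^ n * mlKernel α μ n (α * n + β) (t - n * τ)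

section DelayKernel

variable {α τ : ℝ}

theorem delayKernel_of_nonpos (α μ δ : ℝ) (N : ℕ) (β : ℝ) (hτ : 0 ≤ τ) {t : ℝ} (ht : t ≤ 0) :
    delayKernel α τ μ δ N β t = 0 :=
  Finset.sum_eq_zero fun n _ => by
    have : 0 ≤ (n : ℝ) * τ := by positivity
    rw [mlKernel_of_nonpos _ _ _ _ (by linarith), mul_zero]

theorem measurable_delayKernel (hα : 0 < α) (τ μ δ : ℝ) (N : ℕ) (β : ℝ) :
    Measurable (delayKernel α τ μ δ N β) :=
  Finset.measurable_fun_sum _ fun n _ =>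
    ((measurable_mlKernel hα μ n _).comp (measurable_id.sub_const _)).const_mul _

theorem hasConv_powKernel_delayKernel (hα : 0 < α) (τ μ δ : ℝ) (N : ℕ) {a β : ℝ} (ha : 0 < a)
    (hβ : 0 < β) :
    HasConv (powKernel a) (delayKernel α τ μ δ N β) (delayKernel α τ μ δ N (a + β)) := by
  refine HasConv.sum _ fun n _ => HasConv.const_mul (HasConv.shift ?_ _) _
  have := hasConv_powKernel_mlKernel hα μ n ha (show 0 < α * n + β by positivity)
  rwa [show a + (α * n + β) = α * n + (a + β) by ring] at this

theorem delayKernel_mono {μ δ : ℝ} (hα : 0 < α) (τ : ℝ) (hμ : 0 ≤ μ) (hδ : 0 ≤ δ) (N : ℕ) {β : ℝ}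
    (hβ : 1 ≤ β) : Monotone (delayKernel α τ μ δ N β) := fun s t hst =>
  Finset.sum_le_sum fun n _ => mul_le_mul_of_nonneg_left
    (mlKernel_mono hα hμ n (hβ.trans (le_add_of_nonneg_left (by positivity)))
      (sub_le_sub_right hst _)) (by positivity)

theorem abs_delayKernel_le (hα : 0 < α) (τ μ δ : ℝ) (N : ℕ) {β : ℝ} (hβ : 0 < β) (t : ℝ) :
    |delayKernel α τ μ δ N β t| ≤ delayKernel α τ |μ| |δ| N β t := by
  refine (Finset.abs_sum_le_sum_abs _ _).trans (Finset.sum_le_sum fun n _ => ?_)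
  rw [abs_mul, abs_pow]
  exact mul_le_mul_of_nonneg_left (abs_mlKernel_le hα μ n (by positivity) _) (by positivity)

/-- The majorant convolves to a kernel of index a + β ≥ 1, which is monotone, so its value at t
bounds all u ≤ t. This is the bound required by `HasConv.integral_mul_integral`. -/
theorem exists_integral_abs_powKernel_delayKernel_le (hα : 0 < α) (τ μ δ : ℝ) (N : ℕ) {a β : ℝ}
    (ha : 0 < a) (hβ : 0 < β) (hab : 1 ≤ a + β) (t : ℝ) :
    ∃ C, ∀ u ≤ t, ∫ s, |powKernel a (u - s) * delayKernel α τ μ δ N β s| ≤ C := by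
  refine ⟨delayKernel α τ |μ| |δ| N (a + β) t, fun u hu => ?_⟩
  have H := hasConv_powKernel_delayKernel hα τ |μ| |δ| N ha hβ u
  calc ∫ s, |powKernel a (u - s) * delayKernel α τ μ δ N β s|
      ≤ ∫ s, powKernel a (u - s) * delayKernel α τ |μ| |δ| N β s := by
        refine integral_mono (hasConv_powKernel_delayKernel hα τ μ δ N ha hβ u).1.abs H.1
          fun s => ?_
        simp only [abs_mul, abs_of_nonneg (powKernel_nonneg ha (u - s))]
        exact mul_le_mul_of_nonneg_left (abs_delayKernel_le hα τ μ δ N hβ s)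
          (powKernel_nonneg ha _)
    _ = _ := H.2
    _ ≤ _ := delayKernel_mono hα τ (abs_nonneg μ) (abs_nonneg δ) N hab hu

/-- The n = 0 summand obeys `mlKernel_zero`, the others `mlKernel_succ`. The lower-order part of
summand n+1 is summand n of the delayed kernel, because α(n+1) + 1 = αn + (α+1); the index shift is
why the delayed sum has one term fewer. -/
theorem delayKernel_one (hα : 0 < α) (τ μ δ : ℝ) (N : ℕ) (t : ℝ) :
    delayKernel α τ μ δ (N + 1) 1 t = powKernel 1 t + μ * delayKernel α τ μ δ (N + 1) (α + 1) t +
      δ * delayKernel α τ μ δ N (α + 1) (t - τ) := by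
  have e : ∀ n : ℕ, δ ^ (n + 1) * mlKernel α μ (n + 1) (α * (n + 1 : ℕ) + 1) (t - (n + 1 : ℕ) * τ) =
      μ * (δ ^ (n + 1) * mlKernel α μ (n + 1) (α * (n + 1 : ℕ) + (α + 1)) (t - (n + 1 : ℕ) * τ)) +
      δ * (δ ^ n * mlKernel α μ n (α * n + (α + 1)) (t - τ - n * τ)) := by
    intro n
    rw [mlKernel_succ hα,
      show t - τ - n * τ = t - (n + 1 : ℕ) * τ by push_cast; ring,
      show α * (n + 1 : ℕ) + 1 + α = α * (n + 1 : ℕ) + (α + 1) by ring,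
      show α * n + (α + 1) = α * (n + 1 : ℕ) + 1 by push_cast; ring]
    ring
  have e0 := mlKernel_zero hα μ 1 t
  rw [delayKernel, Finset.sum_range_succ', Finset.sum_congr rfl fun n _ => e n,
    Finset.sum_add_distrib, ← Finset.mul_sum, ← Finset.mul_sum, delayKernel, delayKernel,
    Finset.sum_range_succ']
  simp only [pow_zero, Nat.cast_zero, mul_zero, zero_mul, zero_add, sub_zero, one_mul]
  rw [e0, add_comm 1 α]
  ring

theorem delayKernel_succ_of_le (α μ δ : ℝ) (N : ℕ) (β : ℝ) {t : ℝ} (ht : t ≤ N * τ) :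
    delayKernel α τ μ δ (N + 1) β t = delayKernel α τ μ δ N β t := by
  rw [delayKernel, Finset.sum_range_succ, mlKernel_of_nonpos _ _ _ _ (by linarith), mul_zero,
    add_zero, delayKernel]

end DelayKernel

/-! ### Associativity of convolution -/

/-- Associativity of the convolution of functions supported on `[0, ∞)`, at a single point. -/
theorem HasConv.integral_mul_integral {f g h k : ℝ → ℝ} (H : HasConv f g k) (hf : Measurable f)
    (hg : Measurable g) (hhm : Measurable h) (hh : Integrable h) (hh0 : ∀ r ≤ 0, h r = 0) {t C : ℝ}
    (hC : ∀ u ≤ t, ∫ s, |f (u - s) * g s| ≤ C) :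
    Integrable (fun s => f (t - s) * ∫ r, g (s - r) * h r) ∧
      ∫ s, f (t - s) * ∫ r, g (s - r) * h r = ∫ r, k (t - r) * h r := by
  have hm : Measurable (Function.uncurry fun s r : ℝ => f (t - s) * (g (s - r) * h r)) := by
    unfold Function.uncurry
    fun_prop
  have e : ∀ r, (fun s => f (t - s) * (g (s - r) * h r)) =
      fun s => f (t - r - (s - r)) * g (s - r) * h r := fun r => by
    funext s
    ring_nf
  have hshift : ∀ r, Integrable fun s => f (t - r - (s - r)) * g (s - r) := fun r =>
    (H (t - r)).1.comp_sub_right r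
  have hint : ∀ r, Integrable fun s => f (t - s) * (g (s - r) * h r) := fun r => by
    rw [e]
    exact (hshift r).mul_const _
  have hnorm : ∀ r, ∫ s, ‖f (t - s) * (g (s - r) * h r)‖ =
      (∫ s, |f (t - r - s) * g s|) * |h r| := fun r => by
    have e' : (fun s => ‖f (t - s) * (g (s - r) * h r)‖) =
        fun s => |f (t - r - (s - r)) * g (s - r)| * |h r| := by
      funext s
      rw [← abs_mul, ← congrFun (e r) s, Real.norm_eq_abs]
    rw [e', integral_mul_const,
      integral_sub_right_eq_self (fun s => |f (t - r - s) * g s|) r]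
  have hI : Integrable (Function.uncurry fun s r : ℝ => f (t - s) * (g (s - r) * h r))
      (volume.prod volume) := by
    rw [integrable_prod_iff' hm.aestronglyMeasurable]
    refine ⟨Filter.Eventually.of_forall hint, ?_⟩
    -- The inner L¹ norm is dominated by `C * |h r|`: for r > 0 the bound `hC` applies at t - r ≤ t,
    -- and for r ≤ 0 the factor `h r` vanishes.
    refine Integrable.mono' (hh.abs.const_mul C)
      hm.norm.aestronglyMeasurable.prod_swap.integral_prod_right' ?_
    refine Filter.Eventually.of_forall fun r => ?_
    simp only [Function.uncurry_apply_pair]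
    rw [hnorm, Real.norm_eq_abs, abs_mul, abs_abs,
      abs_of_nonneg (integral_nonneg fun s => abs_nonneg _)]
    rcases le_or_gt r 0 with hr | hr
    · simp [hh0 r hr]
    · exact mul_le_mul_of_nonneg_right (hC _ (by linarith)) (abs_nonneg _)
  constructor
  · have := hI.integral_prod_left
    simpa only [Function.uncurry_apply_pair, integral_const_mul] using this
  · have := integral_integral_swap hI
    simp only [integral_const_mul] at this
    rw [this]
    refine integral_congr_ae (Filter.Eventually.of_forall fun r => ?_)
    simp only
    rw [e, integral_mul_const, integral_sub_right_eq_self (fun s => f (t - r - s) * g s) r,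
      (H (t - r)).2]

/-! ### Caputo derivatives of primitives -/

section Caputo

theorem powKernel_sub_mul_eq_indicator {p : ℝ → ℝ} (hp : ∀ s ≤ 0, p s = 0) (a t : ℝ) :
    (fun s => powKernel a (t - s) * p s) =
      (Set.Ioo 0 t).indicator fun s => 1 / Real.Gamma a * (p s / (t - s) ^ (1 - a)) := by
  funext s
  by_cases hs : s ∈ Set.Ioo 0 t
  · have hts : 0 < t - s := sub_pos.2 hs.2
    rw [Set.indicator_of_mem hs, powKernel_of_pos _ hts, ← neg_sub 1 a, Real.rpow_neg hts.le]
    simp only [div_eq_mul_inv]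
    ring
  · rw [Set.indicator_of_notMem hs]
    rcases le_or_gt s 0 with hs0 | hs0
    · rw [hp s hs0, mul_zero]
    · rw [powKernel_of_nonpos, zero_mul]
      by_contra hlt
      exact hs ⟨hs0, by linarith⟩

theorem intervalIntegrable_div_rpow {p : ℝ → ℝ} (hp : ∀ s ≤ 0, p s = 0) {a t : ℝ} (ha : 0 < a)
    (ht : 0 ≤ t) (hi : Integrable fun s => powKernel a (t - s) * p s) :
    IntervalIntegrable (fun s => p s / (t - s) ^ (1 - a)) volume 0 t := by
  rw [powKernel_sub_mul_eq_indicator hp, integrable_indicator_iff measurableSet_Ioo] at hi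
  rw [intervalIntegrable_iff_integrableOn_Ioo_of_le ht]
  refine (hi.const_mul (Real.Gamma a)).congr (Filter.Eventually.of_forall fun s => ?_)
  have := (Real.Gamma_pos_of_pos ha).ne'
  simp only
  field_simp

theorem integral_powKernel_mul {p : ℝ → ℝ} (hp : ∀ s ≤ 0, p s = 0) (a : ℝ) {t : ℝ} (ht : 0 ≤ t) :
    ∫ s, powKernel a (t - s) * p s =
      1 / Real.Gamma a * ∫ s in (0 : ℝ)..t, p s / (t - s) ^ (1 - a) := by
  rw [powKernel_sub_mul_eq_indicator hp, integral_indicator measurableSet_Ioo,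
    ← integral_Ioc_eq_integral_Ioo, ← intervalIntegral.integral_of_le ht,
    intervalIntegral.integral_const_mul]

theorem AbsolutelyContinuousOnInterval.congr_on {f g : ℝ → ℝ} {a b : ℝ}
    (hf : AbsolutelyContinuousOnInterval f a b) (h : ∀ x ∈ Set.uIcc a b, f x = g x) :
    AbsolutelyContinuousOnInterval g a b := by
  rw [absolutelyContinuousOnInterval_iff] at hf ⊢
  intro ε hε
  obtain ⟨η, hη, H⟩ := hf ε hε
  refine ⟨η, hη, fun E hE hEη => (Finset.sum_congr rfl fun i hi => ?_).trans_lt (H E hE hEη)⟩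
  rw [h _ (hE.1 i hi).1, h _ (hE.1 i hi).2]

theorem HasCaputoDerivAt.of_integral {α t A₀ v : ℝ} {A p : ℝ → ℝ} (hα₀ : 0 < α) (hα₁ : α < 1)
    (ht : 0 < t) (hA : ∀ s ∈ Set.Icc 0 t, A s = A₀ + ∫ r in (0 : ℝ)..s, p r)
    (hp : IntervalIntegrable p volume 0 t)
    (hp' : IntervalIntegrable (fun s => p s / (t - s) ^ α) volume 0 t)
    (hv : 1 / Real.Gamma (1 - α) * ∫ s in (0 : ℝ)..t, p s / (t - s) ^ α = v) :
    HasCaputoDerivAt α A v t := by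
  have hac : AbsolutelyContinuousOnInterval A 0 t := by
    have h1 := hp.absolutelyContinuousOnInterval_intervalIntegral (c := 0) (by simp)
    have h2 : AbsolutelyContinuousOnInterval (fun _ : ℝ => A₀) 0 t :=
      ((LipschitzWith.const A₀).lipschitzOnWith).absolutelyContinuousOnInterval
    refine (h2.add h1).congr_on fun s hs => ?_
    rw [Set.uIcc_of_le ht.le] at hs
    exact (hA s hs).symm
  -- Lebesgue differentiation: an integrable density suffices, since the Caputo integral sees `deriv
  -- A` only almost everywhere.
  have hd : ∀ᵐ s, s ∈ Set.Ioo 0 t → deriv A s = p s := by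
    filter_upwards [hp.ae_hasDerivAt_integral] with s hs hst
    have h1 := (hs (by rw [Set.uIcc_of_le ht.le]; exact Set.Ioo_subset_Icc_self hst) 0
      (by simp)).const_add A₀
    refine HasDerivAt.deriv (h1.congr_of_eventuallyEq ?_)
    filter_upwards [Ioo_mem_nhds hst.1 hst.2] with r hr
    exact hA r (Set.Ioo_subset_Icc_self hr)
  have hd' : ∀ᵐ s ∂volume.restrict (Set.uIoc 0 t), p s / (t - s) ^ α = deriv A s / (t - s) ^ α := by
    rw [Set.uIoc_of_le ht.le, ← restrict_Ioo_eq_restrict_Ioc,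
      ae_restrict_iff' measurableSet_Ioo]
    filter_upwards [hd] with s hs hst
    rw [hs hst]
  refine Or.inr ⟨hα₀, hα₁, hac, hp'.congr_ae hd', ?_⟩
  rw [← hv]
  congr 1
  exact intervalIntegral.integral_congr_ae_restrict hd'

theorem HasCaputoDerivAt.const_mul {α t v : ℝ} {A : ℝ → ℝ} (c : ℝ)
    (h : HasCaputoDerivAt α A v t) : HasCaputoDerivAt α (fun s => c * A s) (c * v) t := by
  rcases h with ⟨h1, h2⟩ | ⟨h0, h1, h2, h3, h4⟩
  · exact Or.inl ⟨h1, h2.const_mul c⟩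
  · have e : (fun s => deriv (fun s => c * A s) s / (t - s) ^ α) =
        fun s => c * (deriv A s / (t - s) ^ α) := by
      funext s
      rw [deriv_const_mul_field, mul_div_assoc]
    refine Or.inr ⟨h0, h1, h2.const_mul c, ?_, ?_⟩
    · rw [e]
      exact h3.const_mul c
    · rw [e, intervalIntegral.integral_const_mul, h4]
      ring

theorem HasCaputoDerivAt.add {α t v w : ℝ} {A B : ℝ → ℝ} (hA : HasCaputoDerivAt α A v t)
    (hB : HasCaputoDerivAt α B w t) : HasCaputoDerivAt α (fun s => A s + B s) (v + w) t := by
  rcases hA with ⟨h1, h2⟩ | ⟨h0, h1, h2, h3, h4⟩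
  · rcases hB with ⟨_, k2⟩ | ⟨_, k1, _⟩
    · exact Or.inl ⟨h1, h2.add k2⟩
    · exact absurd h1 k1.ne
  · rcases hB with ⟨k1, _⟩ | ⟨_, _, k2, k3, k4⟩
    · exact absurd k1 h1.ne
    have e : ∀ᵐ s ∂volume.restrict (Set.uIoc 0 t),
        deriv A s / (t - s) ^ α + deriv B s / (t - s) ^ α =
          deriv (fun s => A s + B s) s / (t - s) ^ α := by
      rw [ae_restrict_iff' measurableSet_uIoc]
      filter_upwards [h2.ae_differentiableAt, k2.ae_differentiableAt] with s hs ks hst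
      rw [deriv_fun_add (hs (Set.uIoc_subset_uIcc hst)) (ks (Set.uIoc_subset_uIcc hst)), add_div]
    refine Or.inr ⟨h0, h1, h2.add k2, (h3.add k3).congr_ae e, ?_⟩
    rw [← intervalIntegral.integral_congr_ae_restrict e, intervalIntegral.integral_add h3 k3,
      mul_add, ← h4, ← k4]

end Caputo

/-! ### The delayed history -/

section History

variable {τ : ℝ} {ψ : ℝ → ℝ}

/-- The history `ψ` on `(-τ, 0]`, delayed by `τ` and extended by `0`. -/
noncomputable def delayedHistory (τ : ℝ) (ψ : ℝ → ℝ) : ℝ → ℝ :=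
  (Set.Ioc 0 τ).indicator fun t => ψ (t - τ)

/-- The derivative of the history `ψ`, delayed by `τ` and extended by `0`. -/
noncomputable def delayedHistoryDeriv (τ : ℝ) (ψ : ℝ → ℝ) : ℝ → ℝ :=
  (Set.Ioc 0 τ).indicator fun t => deriv ψ (t - τ)

theorem delayedHistoryDeriv_of_nonpos (τ : ℝ) (ψ : ℝ → ℝ) {t : ℝ} (ht : t ≤ 0) :
    delayedHistoryDeriv τ ψ t = 0 :=
  Set.indicator_of_notMem (fun h => (h.1.trans_le ht).false) _

theorem measurable_delayedHistoryDeriv (τ : ℝ) (ψ : ℝ → ℝ) :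
    Measurable (delayedHistoryDeriv τ ψ) :=
  ((measurable_deriv ψ).comp (measurable_id.sub_const τ)).indicator measurableSet_Ioc

theorem integrable_delayedHistoryDeriv (hτ : 0 ≤ τ)
    (hψ : AbsolutelyContinuousOnInterval ψ (-τ) 0) : Integrable (delayedHistoryDeriv τ ψ) := by
  have h := hψ.intervalIntegrable_deriv.comp_sub_right τ
  rw [neg_add_cancel, zero_add, intervalIntegrable_iff_integrableOn_Ioc_of_le hτ] at h
  exact (integrable_indicator_iff measurableSet_Ioc).2 h

/-- The primitive of the truncated derivative is ψ(t-τ) - ψ(-τ) up to time τ and stays at ψ(0) -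
ψ(-τ) afterwards. The two extra terms account for the jumps of the truncated history at 0 and τ. -/
theorem integral_powKernel_one_delayedHistoryDeriv (hτ : 0 < τ)
    (hψ : AbsolutelyContinuousOnInterval ψ (-τ) 0) (t : ℝ) :
    ∫ r, powKernel 1 (t - r) * delayedHistoryDeriv τ ψ r =
      delayedHistory τ ψ t - ψ (-τ) * powKernel 1 t + ψ 0 * powKernel 1 (t - τ) := by
  have hp : ∀ r ≤ 0, delayedHistoryDeriv τ ψ r = 0 := fun r hr =>
    delayedHistoryDeriv_of_nonpos τ ψ hr
  rcases le_or_gt t 0 with ht | ht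
  · have e : ∀ r, powKernel 1 (t - r) * delayedHistoryDeriv τ ψ r = 0 := by
      intro r
      rcases le_or_gt r 0 with hr | hr
      · rw [hp r hr, mul_zero]
      · rw [powKernel_of_nonpos _ (by linarith), zero_mul]
    simp only [e]
    rw [powKernel_of_nonpos _ ht, powKernel_of_nonpos _ (by linarith : t - τ ≤ 0), delayedHistory,
      Set.indicator_of_notMem fun h => (h.1.trans_le ht).false]
    simp
  · have hint : ∀ x, 0 ≤ x → x ≤ τ → ∫ r in (0 : ℝ)..x, deriv ψ (r - τ) = ψ (x - τ) - ψ (-τ) := by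
      intro x hx hxτ
      rw [intervalIntegral.integral_comp_sub_right (fun r => deriv ψ r), zero_sub]
      refine (hψ.mono ?_).integral_deriv_eq_sub
      rw [Set.uIcc_of_le (by linarith), Set.uIcc_of_le (by linarith)]
      exact Set.Icc_subset_Icc le_rfl (by linarith)
    have e : ∫ r in (0 : ℝ)..t, delayedHistoryDeriv τ ψ r =
        ∫ r in (0 : ℝ)..(min t τ), deriv ψ (r - τ) := by
      rw [intervalIntegral.integral_of_le ht.le, intervalIntegral.integral_of_le (by positivity),
        delayedHistoryDeriv, integral_indicator measurableSet_Ioc,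
        Measure.restrict_restrict measurableSet_Ioc, Set.Ioc_inter_Ioc, max_self, min_comm]
    rw [integral_powKernel_mul hp 1 ht.le]
    simp only [sub_self, Real.rpow_zero, div_one, Real.Gamma_one, one_mul]
    rw [e, hint _ (by positivity) (min_le_right _ _), powKernel_one_of_pos ht, delayedHistory]
    rcases le_or_gt t τ with htτ | htτ
    · rw [min_eq_left htτ, Set.indicator_of_mem (Set.mem_Ioc.2 ⟨ht, htτ⟩),
        powKernel_of_nonpos _ (by linarith)]
      ring
    · rw [min_eq_right htτ.le, Set.indicator_of_notMem fun h => (h.2.trans_lt htτ).false,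
        powKernel_one_of_pos (by linarith), sub_self]
      ring

theorem exists_abs_delayedHistory_le (hτ : 0 ≤ τ)
    (hψ : AbsolutelyContinuousOnInterval ψ (-τ) 0) : ∃ C, ∀ t, ‖delayedHistory τ ψ t‖ ≤ C := by
  obtain ⟨C, hC⟩ := hψ.exists_bound
  refine ⟨max C 0, fun t => ?_⟩
  unfold delayedHistory
  by_cases ht : t ∈ Set.Ioc 0 τ
  · rw [Set.indicator_of_mem ht]
    refine (hC _ ?_).trans (le_max_left _ _)
    rw [Set.uIcc_of_le (by linarith)]
    exact ⟨by linarith [ht.1], by linarith [ht.2]⟩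
  · rw [Set.indicator_of_notMem ht, norm_zero]
    exact le_max_right _ _

theorem aestronglyMeasurable_delayedHistory (hτ : 0 ≤ τ)
    (hψ : AbsolutelyContinuousOnInterval ψ (-τ) 0) :
    AEStronglyMeasurable (delayedHistory τ ψ) := by
  refine (aestronglyMeasurable_indicator_iff measurableSet_Ioc).2
    (ContinuousOn.aestronglyMeasurable ?_ measurableSet_Ioc)
  refine hψ.continuousOn.comp (by fun_prop) fun t ht => ?_
  rw [Set.uIcc_of_le (by linarith)]
  exact ⟨by linarith [ht.1], by linarith [ht.2]⟩

theorem integrable_mul_delayedHistory (hτ : 0 ≤ τ)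
    (hψ : AbsolutelyContinuousOnInterval ψ (-τ) 0) {f : ℝ → ℝ}
    (hf : Integrable fun s => f s * powKernel 1 s) :
    Integrable fun s => f s * delayedHistory τ ψ s := by
  obtain ⟨C, hC⟩ := exists_abs_delayedHistory_le hτ hψ
  have e : (fun s => f s * delayedHistory τ ψ s) =
      fun s => f s * powKernel 1 s * delayedHistory τ ψ s := by
    funext s
    rcases le_or_gt s 0 with hs | hs
    · rw [delayedHistory, Set.indicator_of_notMem fun h => (h.1.trans_le hs).false]
      simp
    · rw [powKernel_one_of_pos hs, mul_one]
  rw [e]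
  exact hf.mul_bdd (aestronglyMeasurable_delayedHistory hτ hψ) (Filter.Eventually.of_forall hC)

end History

/-! ### Representations of the explicit coefficient -/

section Representation

variable {α τ : ℝ} {ψ : ℝ → ℝ}

theorem integrable_delayKernel_mul_delayedHistoryDeriv (hα : 0 < α) (hτ : 0 ≤ τ) (μ δ : ℝ) (N : ℕ)
    {β : ℝ} (hβ : 1 ≤ β) (hψ : AbsolutelyContinuousOnInterval ψ (-τ) 0) (t : ℝ) :
    Integrable fun r => delayKernel α τ μ δ N β (t - r) * delayedHistoryDeriv τ ψ r := by
  refine Integrable.mono' ((integrable_delayedHistoryDeriv hτ hψ).abs.const_mul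
    (delayKernel α τ |μ| |δ| N β t)) ?_ (Filter.Eventually.of_forall fun r => ?_)
  · exact (((measurable_delayKernel hα τ μ δ N β).comp (measurable_const.sub measurable_id)).mul
      (measurable_delayedHistoryDeriv τ ψ)).aestronglyMeasurable
  · rw [Real.norm_eq_abs, abs_mul]
    rcases le_or_gt r 0 with hr | hr
    · simp [delayedHistoryDeriv_of_nonpos τ ψ hr]
    · exact mul_le_mul_of_nonneg_right ((abs_delayKernel_le hα τ μ δ N (by linarith) _).trans
        (delayKernel_mono hα τ (abs_nonneg μ) (abs_nonneg δ) N hβ (by linarith))) (abs_nonneg _)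

theorem powKernel_conv_delayKernel_conv (hα : 0 < α) (hτ : 0 ≤ τ) (μ δ : ℝ) (N : ℕ)
    {a : ℝ} (ha : 0 < a) (haα : 1 ≤ a + α) (hψ : AbsolutelyContinuousOnInterval ψ (-τ) 0) (t : ℝ) :
    Integrable (fun s => powKernel a (t - s) *
        ∫ r, delayKernel α τ μ δ N α (s - r) * delayedHistoryDeriv τ ψ r) ∧
      ∫ s, powKernel a (t - s) *
          ∫ r, delayKernel α τ μ δ N α (s - r) * delayedHistoryDeriv τ ψ r =
        ∫ r, delayKernel α τ μ δ N (a + α) (t - r) * delayedHistoryDeriv τ ψ r := by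
  obtain ⟨C, hC⟩ := exists_integral_abs_powKernel_delayKernel_le hα τ μ δ N ha hα haα t
  exact (hasConv_powKernel_delayKernel hα τ μ δ N ha hα).integral_mul_integral
    (measurable_powKernel a) (measurable_delayKernel hα τ μ δ N α)
    (measurable_delayedHistoryDeriv τ ψ) (integrable_delayedHistoryDeriv hτ hψ)
    (fun r hr => delayedHistoryDeriv_of_nonpos τ ψ hr) hC

/-- Integration by parts through associativity: K_{α+1} = K_α * `powKernel 1`, and convolving
`powKernel 1` with the history derivative returns the history and its jump terms. -/
theorem integral_delayKernel_mul_delayedHistoryDeriv (hα : 0 < α) (hτ : 0 < τ) (μ δ : ℝ) (N : ℕ)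
    (hψ : AbsolutelyContinuousOnInterval ψ (-τ) 0) (t : ℝ) :
    ∫ r, delayKernel α τ μ δ N (α + 1) (t - r) * delayedHistoryDeriv τ ψ r =
      (∫ s, delayKernel α τ μ δ N α (t - s) * delayedHistory τ ψ s) -
        ψ (-τ) * delayKernel α τ μ δ N (α + 1) t +
        ψ 0 * delayKernel α τ μ δ N (α + 1) (t - τ) := by
  have H : HasConv (delayKernel α τ μ δ N α) (powKernel 1) (delayKernel α τ μ δ N (α + 1)) := by
    have := (hasConv_powKernel_delayKernel hα τ μ δ N one_pos hα).comm
    rwa [add_comm 1 α] at this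
  obtain ⟨C, hC⟩ := exists_integral_abs_powKernel_delayKernel_le hα τ μ δ N one_pos hα
    (by linarith) t
  have hC' : ∀ u ≤ t, ∫ s, |delayKernel α τ μ δ N α (u - s) * powKernel 1 s| ≤ C := by
    intro u hu
    refine le_trans (le_of_eq ?_) (hC u hu)
    rw [← integral_sub_left_eq_self _ volume u]
    simp only [sub_sub_cancel, mul_comm]
  have h1 := (H.integral_mul_integral (measurable_delayKernel hα τ μ δ N α) (measurable_powKernel 1)
    (measurable_delayedHistoryDeriv τ ψ) (integrable_delayedHistoryDeriv hτ.le hψ)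
    (fun r hr => delayedHistoryDeriv_of_nonpos τ ψ hr) hC').2
  rw [← h1]
  have hF := integrable_mul_delayedHistory hτ.le hψ (H t).1
  have hP := (H.const_mul (ψ (-τ))) t
  have hS := ((H.shift τ).const_mul (ψ 0)) t
  beta_reduce at hP hS
  simp only [integral_powKernel_one_delayedHistoryDeriv hτ hψ, mul_add, mul_sub]
  have hFP : Integrable fun s => delayKernel α τ μ δ N α (t - s) * delayedHistory τ ψ s -
      delayKernel α τ μ δ N α (t - s) * (ψ (-τ) * powKernel 1 s) := hF.sub hP.1
  rw [integral_add hFP hS.1, integral_sub hF hP.1, hP.2, hS.2]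

/-- The derivative of `delayCoeff` on `(0, N τ)`. -/
noncomputable def delayDensity (α τ μ δ c : ℝ) (ψ : ℝ → ℝ) (N : ℕ) (s : ℝ) : ℝ :=
  (μ * ψ 0 + δ * ψ (-τ) + c) * delayKernel α τ μ δ N α s +
    δ * ∫ r, delayKernel α τ μ δ N α (s - r) * delayedHistoryDeriv τ ψ r

theorem delayDensity_of_nonpos (hτ : 0 ≤ τ) (μ δ c : ℝ) (N : ℕ) {s : ℝ} (hs : s ≤ 0) :
    delayDensity α τ μ δ c ψ N s = 0 := by
  have e : ∀ r, delayKernel α τ μ δ N α (s - r) * delayedHistoryDeriv τ ψ r = 0 := by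
    intro r
    rcases le_or_gt r 0 with hr | hr
    · rw [delayedHistoryDeriv_of_nonpos τ ψ hr, mul_zero]
    · rw [delayKernel_of_nonpos α μ δ N α hτ (by linarith), zero_mul]
  simp only [delayDensity, e, delayKernel_of_nonpos α μ δ N α hτ hs]
  simp

theorem powKernel_conv_delayDensity (hα : 0 < α) (hτ : 0 ≤ τ) (μ δ c : ℝ) (N : ℕ)
    {a : ℝ} (ha : 0 < a) (haα : 1 ≤ a + α) (hψ : AbsolutelyContinuousOnInterval ψ (-τ) 0) (t : ℝ) :
    Integrable (fun s => powKernel a (t - s) * delayDensity α τ μ δ c ψ N s) ∧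
      ∫ s, powKernel a (t - s) * delayDensity α τ μ δ c ψ N s =
        (μ * ψ 0 + δ * ψ (-τ) + c) * delayKernel α τ μ δ N (a + α) t +
          δ * ∫ r, delayKernel α τ μ δ N (a + α) (t - r) * delayedHistoryDeriv τ ψ r := by
  have h1 := ((hasConv_powKernel_delayKernel hα τ μ δ N ha hα).const_mul
    (μ * ψ 0 + δ * ψ (-τ) + c)) t
  have h2 := powKernel_conv_delayKernel_conv hα hτ μ δ N ha haα hψ t
  simp only [delayDensity, mul_add, mul_left_comm (powKernel a _) δ]
  exact ⟨h1.1.add (h2.1.const_mul δ), by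
    rw [integral_add h1.1 (h2.1.const_mul δ), h1.2, integral_const_mul, h2.2]⟩

/-- The case u = 0 needs b ≠ 0 because `0 ^ 0 = 1`, while the kernel is 0 there. -/
theorem rpow_mul_prabhakar_eq_mlKernel (α μ : ℝ) (n : ℕ) {b β u : ℝ} (hb : b = β - 1)
    (hu : 0 ≤ u) (h0 : u = 0 → b ≠ 0) :
    u ^ b * prabhakar α β (n + 1) (μ * u ^ α) = mlKernel α μ n β u := by
  rcases hu.eq_or_lt with rfl | hu
  · rw [Real.zero_rpow (h0 rfl), zero_mul, mlKernel_of_nonpos _ _ _ _ le_rfl]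
  · rw [mlKernel_of_pos _ _ _ _ hu, hb]

theorem integral_history_term (α μ : ℝ) (n : ℕ) {t : ℝ} (hτ : 0 ≤ τ) (ht : 0 ≤ t) :
    ∫ r in (0 : ℝ)..t, heaviside (r - n * τ) * (r - n * τ) ^ (α * n + α - 1) *
      prabhakar α (α * n + α) (n + 1) (μ * (r - n * τ) ^ α) * ψ (t - τ - r) * cutoff (t - τ - r) =
    ∫ s, mlKernel α μ n (α * n + α) (t - s - n * τ) * delayedHistory τ ψ s := by
  have hn : 0 ≤ (n : ℝ) * τ := by positivity
  rw [← integral_sub_left_eq_self _ volume t, intervalIntegral.integral_of_le ht,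
    ← integral_indicator measurableSet_Ioc]
  refine integral_congr_ae ?_
  -- The conventions at the endpoints of `heaviside`, `cutoff` and `delayedHistory` need not agree;
  -- the three breakpoints form a null set.
  have hne : ∀ a : ℝ, ∀ᵐ r : ℝ, r ≠ a := fun a => by simp [ae_iff, measure_singleton]
  filter_upwards [hne (n * τ), hne (t - τ), hne t] with r h1 h2 h3
  rw [sub_sub_cancel]
  by_cases hr : r ∈ Set.Ioc 0 t
  · have hrt : 0 < t - r := sub_pos.2 (lt_of_le_of_ne hr.2 h3)
    rw [Set.indicator_of_mem hr]
    rcases lt_or_gt_of_ne h1 with h1 | h1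
    · rw [heaviside, if_neg (by linarith), mlKernel_of_nonpos _ _ _ _ (by linarith)]
      simp
    · have hpos : 0 < r - n * τ := sub_pos.2 h1
      rw [heaviside, if_pos hpos.le, one_mul, mlKernel_of_pos _ _ _ _ hpos, delayedHistory]
      rcases lt_or_gt_of_ne h2 with h2 | h2
      · rw [cutoff, if_pos (by linarith), Set.indicator_of_notMem fun h => by linarith [h.2]]
        simp
      · rw [cutoff, if_neg (by linarith), Set.indicator_of_mem
          (Set.mem_Ioc.2 ⟨hrt, by linarith⟩), mul_one]
        ring_nf
  · rw [Set.indicator_of_notMem hr]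
    rcases le_or_gt r 0 with hr0 | hr0
    · rw [mlKernel_of_nonpos _ _ _ _ (by linarith), zero_mul]
    · have : t < r := by
        by_contra hlt
        exact hr ⟨hr0, not_lt.1 hlt⟩
      rw [delayedHistory, Set.indicator_of_notMem fun h => by linarith [h.1], mul_zero]

/-- Summands with n > ⌊t/τ⌋ vanish because their kernels are evaluated at nonpositive times. A fixed
N can therefore replace the floor, which makes the formula uniform on (0, Nτ). -/
theorem delayCoeff_eq (hα : 0 < α) (hτ : 0 < τ) (μ δ c : ℝ)
    (hψ : AbsolutelyContinuousOnInterval ψ (-τ) 0) {N : ℕ} {t : ℝ} (ht : 0 < t) (htN : t < N * τ) :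
    delayCoeff α τ μ δ c ψ t = ψ 0 * delayKernel α τ μ δ N 1 t +
      δ * (∫ s, delayKernel α τ μ δ N α (t - s) * delayedHistory τ ψ s) +
      c * delayKernel α τ μ δ N (α + 1) t := by
  have hsub : Finset.range (⌊t / τ⌋₊ + 1) ⊆ Finset.range N := by
    refine Finset.range_subset_range.2 (Nat.succ_le_of_lt ?_)
    rw [Nat.floor_lt (by positivity), div_lt_iff₀ hτ]
    exact htN
  have hin : ∀ n ∈ Finset.range (⌊t / τ⌋₊ + 1), 0 ≤ t - n * τ := by
    intro n hn
    have h1 : n ≤ ⌊t / τ⌋₊ := Nat.lt_succ_iff.1 (Finset.mem_range.1 hn)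
    have h2 := (Nat.le_floor_iff (by positivity)).1 h1
    rw [le_div_iff₀ hτ] at h2
    linarith
  have hout : ∀ n ∉ Finset.range (⌊t / τ⌋₊ + 1), t - n * τ ≤ 0 := by
    intro n hn
    have h1 : ⌊t / τ⌋₊ < n := by simpa [Nat.lt_succ_iff] using hn
    have h2 := (Nat.floor_lt (by positivity)).1 h1
    rw [div_lt_iff₀ hτ] at h2
    linarith
  have hz : ∀ n : ℕ, t - n * τ = 0 → 0 < (n : ℝ) := by
    intro n hn
    rcases Nat.eq_zero_or_pos n with rfl | h
    · simp at hn
      exact absurd hn ht.ne'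
    · exact_mod_cast h
  have hI : ∀ n : ℕ, Integrable fun s =>
      mlKernel α μ n (α * n + α) (t - s - n * τ) * delayedHistory τ ψ s := by
    intro n
    refine integrable_mul_delayedHistory hτ.le hψ ?_
    have := ((hasConv_powKernel_mlKernel hα μ n one_pos
      (show 0 < α * n + α by positivity)).shift (n * τ)).comm t
    exact this.1
  rw [delayCoeff, if_neg ht.not_ge]
  congr 1
  · congr 1
    · congr 1
      rw [delayKernel, ← Finset.sum_subset hsub fun n _ hn => by
        rw [mlKernel_of_nonpos _ _ _ _ (hout n hn), mul_zero]]
      refine Finset.sum_congr rfl fun n hn => ?_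
      rw [mul_assoc, rpow_mul_prabhakar_eq_mlKernel α μ n (by ring) (hin n hn) fun h => ?_]
      have := hz n h
      positivity
    · simp only [delayKernel, Finset.sum_mul, mul_assoc (δ ^ _)]
      rw [integral_finsetSum _ fun n _ => (hI n).const_mul _]
      simp only [integral_const_mul]
      rw [← Finset.sum_subset hsub fun n _ hn => ?_, Finset.mul_sum]
      · refine Finset.sum_congr rfl fun n _ => ?_
        rw [integral_history_term α μ n hτ.le ht.le]
        ring
      · have e : ∀ s, mlKernel α μ n (α * n + α) (t - s - n * τ) * delayedHistory τ ψ s = 0 := by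
          intro s
          rcases le_or_gt s 0 with hs | hs
          · rw [delayedHistory, Set.indicator_of_notMem fun h => by linarith [h.1], mul_zero]
          · rw [mlKernel_of_nonpos _ _ _ _ (by linarith [hout n hn]), zero_mul]
        simp only [e]
        simp
  · rw [delayKernel, ← Finset.sum_subset hsub fun n _ hn => by
      rw [mlKernel_of_nonpos _ _ _ _ (hout n hn), mul_zero], Finset.mul_sum]
    refine Finset.sum_congr rfl fun n hn => ?_
    rw [mul_assoc, add_assoc, rpow_mul_prabhakar_eq_mlKernel α μ n (by ring) (hin n hn) fun h => ?_]
    · ring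
    · positivity

theorem delayCoeff_of_nonpos (α τ μ δ c : ℝ) (ψ : ℝ → ℝ) {t : ℝ} (ht : t ≤ 0) :
    delayCoeff α τ μ δ c ψ t = ψ t := if_pos ht

/-- The term ψ(0) δ K_{α+1}(t-τ) from `delayKernel_one` cancels against the jump at τ from the
integration by parts. -/
theorem delayCoeff_eq_add_delayKernel (hα : 0 < α) (hτ : 0 < τ) (μ δ c : ℝ)
    (hψ : AbsolutelyContinuousOnInterval ψ (-τ) 0) {N : ℕ} {t : ℝ} (ht : 0 < t)
    (htN : t < (N + 1 : ℕ) * τ) :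
    delayCoeff α τ μ δ c ψ t = ψ 0 +
      ((μ * ψ 0 + δ * ψ (-τ) + c) * delayKernel α τ μ δ (N + 1) (α + 1) t +
        δ * ∫ r, delayKernel α τ μ δ (N + 1) (α + 1) (t - r) * delayedHistoryDeriv τ ψ r) := by
  push_cast at htN
  rw [delayCoeff_eq hα hτ μ δ c hψ ht (N := N + 1) (by push_cast; exact htN),
    integral_delayKernel_mul_delayedHistoryDeriv hα hτ μ δ _ hψ, delayKernel_one hα,
    delayKernel_succ_of_le α μ δ N _ (show t - τ ≤ N * τ by linarith), powKernel_one_of_pos ht]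
  ring

/-- For α < 1 the left side is the Caputo derivative of the coefficient. Expanding both K_1 by
`delayKernel_one`, the μ and δ parts reassemble A(t) - ψ(0) and, for t > τ, A(t-τ) - ψ(0); the
unit-step parts supply the rest. -/
theorem delayKernel_one_conv (hα : 0 < α) (hτ : 0 < τ) (μ δ c : ℝ)
    (hψ : AbsolutelyContinuousOnInterval ψ (-τ) 0) {N : ℕ} {t : ℝ} (ht : 0 < t)
    (htN : t < (N + 1 : ℕ) * τ) :
    (μ * ψ 0 + δ * ψ (-τ) + c) * delayKernel α τ μ δ (N + 1) 1 t +
        δ * ∫ r, delayKernel α τ μ δ (N + 1) 1 (t - r) * delayedHistoryDeriv τ ψ r =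
      μ * delayCoeff α τ μ δ c ψ t + δ * delayCoeff α τ μ δ c ψ (t - τ) + c := by
  have htN' : t < (N + 1) * τ := by exact_mod_cast htN
  have hQ := fun t => integrable_delayKernel_mul_delayedHistoryDeriv hα hτ.le μ δ (N + 1)
    (show 1 ≤ α + 1 by linarith) hψ t
  have hP : Integrable fun r => powKernel 1 (t - r) * delayedHistoryDeriv τ ψ r := by
    refine (integrable_delayedHistoryDeriv hτ.le hψ).bdd_mul (c := 1)
      ((measurable_powKernel 1).comp (measurable_const.sub measurable_id)).aestronglyMeasurable
      (Filter.Eventually.of_forall fun r => ?_)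
    unfold powKernel
    split_ifs <;> simp
  have e : ∀ r, delayKernel α τ μ δ (N + 1) 1 (t - r) * delayedHistoryDeriv τ ψ r =
      powKernel 1 (t - r) * delayedHistoryDeriv τ ψ r +
      μ * (delayKernel α τ μ δ (N + 1) (α + 1) (t - r) * delayedHistoryDeriv τ ψ r) +
      δ * (delayKernel α τ μ δ (N + 1) (α + 1) (t - τ - r) * delayedHistoryDeriv τ ψ r) := by
    intro r
    rcases le_or_gt r 0 with hr | hr
    · simp [delayedHistoryDeriv_of_nonpos τ ψ hr]
    · rw [delayKernel_one hα,
        delayKernel_succ_of_le α μ δ N _ (show t - τ - r ≤ N * τ by linarith),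
        show t - r - τ = t - τ - r by ring]
      ring
  simp only [e]
  rw [integral_add (hP.fun_add ((hQ t).const_mul μ)) ((hQ (t - τ)).const_mul δ),
    integral_add hP ((hQ t).const_mul μ), integral_const_mul, integral_const_mul,
    integral_powKernel_one_delayedHistoryDeriv hτ hψ, delayKernel_one hα,
    ← delayKernel_succ_of_le α μ δ N _ (show t - τ ≤ N * τ by linarith),
    powKernel_one_of_pos ht, delayCoeff_eq_add_delayKernel hα hτ μ δ c hψ ht htN, delayedHistory]
  -- Up to time τ the delayed value is the history itself and the delayed kernels vanish; afterwards
  -- the history term is 0 and the representation applies at t - τ.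
  rcases le_or_gt t τ with htτ | htτ
  · have e0 : ∀ r, delayKernel α τ μ δ (N + 1) (α + 1) (t - τ - r) *
        delayedHistoryDeriv τ ψ r = 0 := by
      intro r
      rcases le_or_gt r 0 with hr | hr
      · rw [delayedHistoryDeriv_of_nonpos τ ψ hr, mul_zero]
      · rw [delayKernel_of_nonpos α μ δ _ _ hτ.le (by linarith), zero_mul]
    simp only [e0, integral_zero]
    rw [delayCoeff_of_nonpos α τ μ δ c ψ (by linarith : t - τ ≤ 0),
      Set.indicator_of_mem (Set.mem_Ioc.2 ⟨ht, htτ⟩), powKernel_of_nonpos _ (by linarith : t - τ ≤ 0),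
      delayKernel_of_nonpos α μ δ _ _ hτ.le (by linarith : t - τ ≤ 0)]
    ring
  · rw [delayCoeff_eq_add_delayKernel hα hτ μ δ c hψ (N := N) (sub_pos.2 htτ)
      (by push_cast; linarith), Set.indicator_of_notMem fun h => (h.2.trans_lt htτ).false,
      powKernel_one_of_pos (by linarith)]
    ring

end Representation

/-! ### The coefficient solves the delay equation -/

section Solution

variable {α τ : ℝ} {ψ : ℝ → ℝ}

theorem exists_nat_lt_succ_mul (hτ : 0 < τ) (t : ℝ) : ∃ N : ℕ, t < (N + 1 : ℕ) * τ := by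
  obtain ⟨N, hN⟩ := exists_nat_gt (t / τ)
  refine ⟨N, ?_⟩
  rw [div_lt_iff₀ hτ] at hN
  push_cast
  linarith

theorem intervalIntegrable_delayDensity (hα : 0 < α) (hτ : 0 ≤ τ) (μ δ c : ℝ) (N : ℕ)
    (hψ : AbsolutelyContinuousOnInterval ψ (-τ) 0) {t : ℝ} (ht : 0 ≤ t) :
    IntervalIntegrable (delayDensity α τ μ δ c ψ N) volume 0 t := by
  have := intervalIntegrable_div_rpow (fun s hs => delayDensity_of_nonpos hτ μ δ c N hs) one_pos ht
    (powKernel_conv_delayDensity hα hτ μ δ c N one_pos (by linarith) hψ t).1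
  simpa using this

theorem delayCoeff_eq_add_integral (hα : 0 < α) (hτ : 0 < τ) (μ δ c : ℝ)
    (hψ : AbsolutelyContinuousOnInterval ψ (-τ) 0) {N : ℕ} {t : ℝ} (ht : 0 ≤ t)
    (htN : t < (N + 1 : ℕ) * τ) :
    delayCoeff α τ μ δ c ψ t = ψ 0 + ∫ s in (0 : ℝ)..t, delayDensity α τ μ δ c ψ (N + 1) s := by
  rcases ht.eq_or_lt with rfl | ht
  · rw [delayCoeff_of_nonpos _ _ _ _ _ _ le_rfl, intervalIntegral.integral_same, add_zero]
  · have h1 := integral_powKernel_mul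
      (fun s hs => delayDensity_of_nonpos (α := α) (ψ := ψ) hτ.le μ δ c (N + 1) hs) 1 ht.le
    rw [(powKernel_conv_delayDensity hα hτ.le μ δ c _ one_pos (by linarith) hψ t).2] at h1
    simp only [sub_self, Real.rpow_zero, div_one, Real.Gamma_one, one_mul] at h1
    rw [delayCoeff_eq_add_delayKernel hα hτ μ δ c hψ ht htN, add_comm α 1, h1]

/-- Used when α = 1. The history and the primitive agree at 0, so continuity on two closed intervals
glues across 0, which the delayed argument crosses at t = τ. -/
theorem continuousOn_delayCoeff (hα : 0 < α) (hτ : 0 < τ) (μ δ c : ℝ)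
    (hψ : AbsolutelyContinuousOnInterval ψ (-τ) 0) :
    ContinuousOn (delayCoeff α τ μ δ c ψ) (Set.Ici (-τ)) := by
  have h1 : ContinuousOn (delayCoeff α τ μ δ c ψ) (Set.Icc (-τ) 0) := by
    have := hψ.continuousOn
    rw [Set.uIcc_of_le (by linarith)] at this
    exact this.congr fun t ht => delayCoeff_of_nonpos _ _ _ _ _ _ ht.2
  have h2 : ∀ T, 0 ≤ T → ContinuousOn (delayCoeff α τ μ δ c ψ) (Set.Icc 0 T) := by
    intro T hT
    obtain ⟨N, hN⟩ := exists_nat_lt_succ_mul hτ T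
    have := (intervalIntegrable_delayDensity hα hτ.le μ δ c (N + 1) hψ hT)
      |>.absolutelyContinuousOnInterval_intervalIntegral (c := 0) (by simp) |>.continuousOn
    rw [Set.uIcc_of_le hT] at this
    exact (continuousOn_const.add this).congr fun t ht =>
      delayCoeff_eq_add_integral hα hτ μ δ c hψ ht.1 (ht.2.trans_lt hN)
  intro t ht
  have h3 := h1.union_of_isClosed (h2 (|t| + 1) (by positivity)) isClosed_Icc isClosed_Icc
  rw [Set.Icc_union_Icc_eq_Icc (by linarith) (by positivity)] at h3
  have htT : t < |t| + 1 := by linarith [le_abs_self t]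
  refine (h3 t ⟨ht, htT.le⟩).mono_of_mem_nhdsWithin ?_
  rw [← Set.Ici_inter_Iic]
  exact Filter.inter_mem self_mem_nhdsWithin (nhdsWithin_le_nhds (Iic_mem_nhds htT))

theorem isDelayODESolution_delayCoeff (hα₀ : 0 < α) (hα₁ : α ≤ 1) (hτ : 0 < τ) (μ δ c : ℝ)
    (hψ : AbsolutelyContinuousOnInterval ψ (-τ) 0) :
    IsDelayODESolution α τ μ δ c ψ (delayCoeff α τ μ δ c ψ) := by
  refine ⟨fun t ht => delayCoeff_of_nonpos _ _ _ _ _ _ ht.2, fun t ht => ?_⟩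
  obtain ⟨N, hN⟩ := exists_nat_lt_succ_mul hτ t
  have hp : ∀ s ≤ 0, delayDensity α τ μ δ c ψ (N + 1) s = 0 := fun s hs =>
    delayDensity_of_nonpos hτ.le μ δ c (N + 1) hs
  rcases hα₁.lt_or_eq with hα₁ | rfl
  · have H := powKernel_conv_delayDensity hα₀ hτ.le μ δ c (N + 1) (sub_pos.2 hα₁)
      (by linarith) hψ t
    have hi := intervalIntegrable_div_rpow hp (sub_pos.2 hα₁) ht.le H.1
    have hv := H.2
    rw [integral_powKernel_mul hp _ ht.le] at hv
    simp only [sub_sub_cancel, sub_add_cancel] at hi hv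
    rw [delayKernel_one_conv hα₀ hτ μ δ c hψ ht hN] at hv
    exact HasCaputoDerivAt.of_integral hα₀ hα₁ ht
      (fun s hs => delayCoeff_eq_add_integral hα₀ hτ μ δ c hψ hs.1 (hs.2.trans_lt hN))
      (intervalIntegrable_delayDensity hα₀ hτ.le μ δ c _ hψ ht.le) hi hv
  -- For α = 1 an almost everywhere derivative is not enough. The density equals μA(s) + δA(s-τ) +
  -- c, hence is continuous, and the primitive is differentiable at t itself.
  · refine Or.inl ⟨rfl, ?_⟩
    have hA := continuousOn_delayCoeff one_pos hτ μ δ c hψ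
    have hd : ∀ s ∈ Set.Ioo 0 ((N + 1 : ℕ) * τ), μ * delayCoeff 1 τ μ δ c ψ s +
        δ * delayCoeff 1 τ μ δ c ψ (s - τ) + c = delayDensity 1 τ μ δ c ψ (N + 1) s :=
      fun s hs => (delayKernel_one_conv one_pos hτ μ δ c hψ hs.1 hs.2).symm
    have hc : ∀ s ∈ Set.Ioo 0 ((N + 1 : ℕ) * τ),
        ContinuousAt (delayDensity 1 τ μ δ c ψ (N + 1)) s := by
      intro s hs
      have h1 : ContinuousAt (delayCoeff 1 τ μ δ c ψ) s :=
        hA.continuousAt (Ici_mem_nhds (by linarith [hs.1]))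
      have h2 : ContinuousAt (fun s => delayCoeff 1 τ μ δ c ψ (s - τ)) s :=
        ContinuousAt.comp (f := fun s => s - τ)
          (hA.continuousAt (Ici_mem_nhds (by linarith [hs.1]))) (by fun_prop)
      refine (((h1.const_mul μ).add (h2.const_mul δ)).add_const c).congr ?_
      filter_upwards [Ioo_mem_nhds hs.1 hs.2] with r hr
      exact hd r hr
    rw [hd t ⟨ht, hN⟩]
    have hi := intervalIntegrable_delayDensity one_pos hτ.le μ δ c (N + 1) hψ ht.le
    have h3 := intervalIntegral.integral_hasDerivAt_right hi
      (ContinuousAt.stronglyMeasurableAtFilter isOpen_Ioo hc t ⟨ht, hN⟩) (hc t ⟨ht, hN⟩)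
    refine (h3.const_add (ψ 0)).congr_of_eventuallyEq ?_
    filter_upwards [Ioo_mem_nhds ht hN] with r hr
    exact delayCoeff_eq_add_integral one_pos hτ μ δ c hψ hr.1.le hr.2

end Solution

/-! ### Invariant subspaces of the reaction–diffusion operator -/

section InvariantSpaces

theorem mem_linearSpace {w : ℝ → ℝ} : w ∈ linearSpace ↔ ∃ a b : ℝ, w = fun x => a + b * x := by
  rw [linearSpace, Submodule.mem_span_pair]
  refine exists_congr fun a => exists_congr fun b => ?_
  rw [eq_comm]
  refine Eq.congr_right ?_
  funext x
  simp

theorem mem_trigSpace {a₁ : ℝ} {w : ℝ → ℝ} : w ∈ trigSpace a₁ ↔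
    ∃ a b d : ℝ, w = fun x => a + b * Real.cos (√a₁ * x) + d * Real.sin (√a₁ * x) := by
  rw [trigSpace, Submodule.mem_span_triple]
  refine exists_congr fun a => exists_congr fun b => exists_congr fun d => ?_
  rw [eq_comm]
  refine Eq.congr_right ?_
  funext x
  simp

theorem deriv_affine (a b : ℝ) : (deriv fun x : ℝ => a + b * x) = fun _ => b := by
  funext x
  simp

/-- The derivative keeps the shape a + b cos + d sin, with constant term 0, so that `deriv_trig` can
be applied twice. -/
theorem hasDerivAt_trig (k a b d x : ℝ) :
    HasDerivAt (fun x => a + b * Real.cos (k * x) + d * Real.sin (k * x))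
      (0 + (k * d) * Real.cos (k * x) + -(k * b) * Real.sin (k * x)) x := by
  have hk : HasDerivAt (fun x => k * x) k x := by simpa using (hasDerivAt_id x).const_mul k
  have h := ((hk.cos.const_mul b).const_add a).add (hk.sin.const_mul d)
  refine h.congr_deriv ?_
  ring

theorem deriv_trig (k a b d : ℝ) :
    (deriv fun x => a + b * Real.cos (k * x) + d * Real.sin (k * x)) =
      fun x => 0 + (k * d) * Real.cos (k * x) + -(k * b) * Real.sin (k * x) :=
  funext fun x => (hasDerivAt_trig k a b d x).deriv

theorem rdOperator_affine (b₀ c₀ c₁ δ a b a' b' x : ℝ) :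
    rdOperator (fun _ => b₀) (fun v vbar => c₁ * v + δ * vbar + c₀) (fun x => a + b * x)
      (fun x => a' + b' * x) x = (c₁ * a + δ * a' + c₀) + (c₁ * b + δ * b') * x := by
  rw [rdOperator, deriv_affine]
  simp
  ring

theorem rdOperator_trig (b₀ c₀ c₁ δ k a b d a' b' d' x : ℝ) :
    rdOperator (fun _ => b₀) (fun v vbar => c₁ * v + δ * vbar + c₀)
      (fun x => a + b * Real.cos (k * x) + d * Real.sin (k * x))
      (fun x => a' + b' * Real.cos (k * x) + d' * Real.sin (k * x)) x =
    (c₁ * a + δ * a' + c₀) + ((c₁ - k ^ 2 * b₀) * b + δ * b') * Real.cos (k * x) +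
      ((c₁ - k ^ 2 * b₀) * d + δ * d') * Real.sin (k * x) := by
  rw [rdOperator, deriv_trig, deriv_const_mul_field, deriv_trig]
  ring

end InvariantSpaces

/-! ### Separation of variables -/

theorem isDelayRDSolution_affine {α τ b₀ c₀ c₁ δ : ℝ} {ψ φ A B : ℝ → ℝ}
    (hA : IsDelayODESolution α τ c₁ δ c₀ ψ A) (hB : IsDelayODESolution α τ c₁ δ 0 φ B) :
    IsDelayRDSolution α τ (fun _ => b₀) (fun v vbar => c₁ * v + δ * vbar + c₀)
      (fun x t => ψ t + φ t * x) (fun x t => A t + B t * x) := by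
  refine ⟨fun x t ht => by simp only [hA.1 t ht, hB.1 t ht], fun t _ => ⟨by fun_prop, ?_⟩,
    fun x t ht => ?_⟩
  · rw [deriv_affine]
    fun_prop
  · rw [rdOperator_affine]
    -- With x fixed, u is a linear combination of the coefficients, so linearity of the Caputo
    -- derivative suffices.
    have h := (hA.2 t ht).add ((hB.2 t ht).const_mul x)
    simp only [mul_comm x] at h
    convert h using 1
    ring

theorem isDelayRDSolution_trig {α τ b₀ c₀ c₁ δ a₁ : ℝ} (ha₁ : 0 ≤ a₁) {ψ φ η A B D : ℝ → ℝ}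
    (hA : IsDelayODESolution α τ c₁ δ c₀ ψ A)
    (hB : IsDelayODESolution α τ (c₁ - a₁ * b₀) δ 0 φ B)
    (hD : IsDelayODESolution α τ (c₁ - a₁ * b₀) δ 0 η D) :
    IsDelayRDSolution α τ (fun _ => b₀) (fun v vbar => c₁ * v + δ * vbar + c₀)
      (fun x t => ψ t + φ t * Real.cos (√a₁ * x) + η t * Real.sin (√a₁ * x))
      (fun x t => A t + B t * Real.cos (√a₁ * x) + D t * Real.sin (√a₁ * x)) := by
  refine ⟨fun x t ht => by simp only [hA.1 t ht, hB.1 t ht, hD.1 t ht], fun t _ => ⟨by fun_prop, ?_⟩,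
    fun x t ht => ?_⟩
  · rw [deriv_trig]
    fun_prop
  · rw [rdOperator_trig, Real.sq_sqrt ha₁]
    have h := ((hA.2 t ht).add ((hB.2 t ht).const_mul (Real.cos (√a₁ * x)))).add
      ((hD.2 t ht).const_mul (Real.sin (√a₁ * x)))
    simp only [mul_comm (Real.cos (√a₁ * x)), mul_comm (Real.sin (√a₁ * x))] at h
    convert h using 1
    ring

theorem mainTheorem5 (α τ b₀ c₀ c₁ δ : ℝ) (hα₀ : 0 < α) (hα₁ : α ≤ 1) (hτ : 0 < τ) :
    -- polynomial solutions
    ((∀ w ∈ linearSpace, ∀ wbar ∈ linearSpace,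
        rdOperator (fun _ => b₀) (fun v vbar => c₁ * v + δ * vbar + c₀) w wbar ∈ linearSpace) ∧
      ∀ ψ φ : ℝ → ℝ, AbsolutelyContinuousOnInterval ψ (-τ) 0 →
        AbsolutelyContinuousOnInterval φ (-τ) 0 →
        IsDelayODESolution α τ c₁ δ c₀ ψ (delayCoeff α τ c₁ δ c₀ ψ) ∧
        IsDelayODESolution α τ c₁ δ 0 φ (delayCoeff α τ c₁ δ 0 φ) ∧
        (∀ t : ℝ, (fun x : ℝ => delayCoeff α τ c₁ δ c₀ ψ t + delayCoeff α τ c₁ δ 0 φ t * x)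
          ∈ linearSpace) ∧
        IsDelayRDSolution α τ (fun _ => b₀) (fun v vbar => c₁ * v + δ * vbar + c₀)
          (fun x t => ψ t + φ t * x)
          (fun x t => delayCoeff α τ c₁ δ c₀ ψ t + delayCoeff α τ c₁ δ 0 φ t * x)) ∧
    -- trigonometric solutions
    (∀ a₁ : ℝ, 0 ≤ a₁ →
      (∀ w ∈ trigSpace a₁, ∀ wbar ∈ trigSpace a₁,
        rdOperator (fun _ => b₀) (fun v vbar => c₁ * v + δ * vbar + c₀) w wbar
          ∈ trigSpace a₁) ∧
      ∀ ψ φ η : ℝ → ℝ, AbsolutelyContinuousOnInterval ψ (-τ) 0 →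
        AbsolutelyContinuousOnInterval φ (-τ) 0 → AbsolutelyContinuousOnInterval η (-τ) 0 →
        IsDelayODESolution α τ c₁ δ c₀ ψ (delayCoeff α τ c₁ δ c₀ ψ) ∧
        IsDelayODESolution α τ (c₁ - a₁ * b₀) δ 0 φ (delayCoeff α τ (c₁ - a₁ * b₀) δ 0 φ) ∧
        IsDelayODESolution α τ (c₁ - a₁ * b₀) δ 0 η (delayCoeff α τ (c₁ - a₁ * b₀) δ 0 η) ∧
        (∀ t : ℝ, (fun x : ℝ => delayCoeff α τ c₁ δ c₀ ψ t
            + delayCoeff α τ (c₁ - a₁ * b₀) δ 0 φ t * Real.cos (√a₁ * x)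
            + delayCoeff α τ (c₁ - a₁ * b₀) δ 0 η t * Real.sin (√a₁ * x)) ∈ trigSpace a₁) ∧
        IsDelayRDSolution α τ (fun _ => b₀) (fun v vbar => c₁ * v + δ * vbar + c₀)
          (fun x t => ψ t + φ t * Real.cos (√a₁ * x) + η t * Real.sin (√a₁ * x))
          (fun x t => delayCoeff α τ c₁ δ c₀ ψ t
            + delayCoeff α τ (c₁ - a₁ * b₀) δ 0 φ t * Real.cos (√a₁ * x)
            + delayCoeff α τ (c₁ - a₁ * b₀) δ 0 η t * Real.sin (√a₁ * x))) := by
  refine ⟨⟨fun w hw wbar hwbar => ?_, fun ψ φ hψ hφ => ?_⟩, fun a₁ ha₁ =>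
    ⟨fun w hw wbar hwbar => ?_, fun ψ φ η hψ hφ hη => ?_⟩⟩
  · obtain ⟨a, b, rfl⟩ := mem_linearSpace.1 hw
    obtain ⟨a', b', rfl⟩ := mem_linearSpace.1 hwbar
    exact mem_linearSpace.2 ⟨_, _, funext fun x => rdOperator_affine ..⟩
  · have hA := isDelayODESolution_delayCoeff hα₀ hα₁ hτ c₁ δ c₀ hψ
    have hB := isDelayODESolution_delayCoeff hα₀ hα₁ hτ c₁ δ 0 hφ
    exact ⟨hA, hB, fun t => mem_linearSpace.2 ⟨_, _, rfl⟩, isDelayRDSolution_affine hA hB⟩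
  · obtain ⟨a, b, d, rfl⟩ := mem_trigSpace.1 hw
    obtain ⟨a', b', d', rfl⟩ := mem_trigSpace.1 hwbar
    exact mem_trigSpace.2 ⟨_, _, _, funext fun x => rdOperator_trig ..⟩
  · have hA := isDelayODESolution_delayCoeff hα₀ hα₁ hτ c₁ δ c₀ hψ
    have hB := isDelayODESolution_delayCoeff hα₀ hα₁ hτ (c₁ - a₁ * b₀) δ 0 hφ
    have hD := isDelayODESolution_delayCoeff hα₀ hα₁ hτ (c₁ - a₁ * b₀) δ 0 hη
    exact ⟨hA, hB, hD, fun t => mem_trigSpace.2 ⟨_, _, _, rfl⟩,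
      isDelayRDSolution_trig ha₁ hA hB hD⟩
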